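/- Let $N=2^M$, $M=0,1,2,\dots$, identify $\mathbb Z_N$ with $\{0,\dots,N-1\}$, and let $\mathcal F f(m)=\sum_{n=0}^{N-1} f(n)e^{-2\pi i mn/N}$ for $f\in\mathbb C^N$. For $J\subseteq\mathbb Z_N$ let $\mathbb B^J$ be the set of $f\in\mathbb C^N$ with $\mathcal F f(m)=0$ for all $m\notin J$. **Homogeneous sets.** The congruence tree of $J\subseteq\mathbb Z_N$ has at level $l$ ($0\le l\le M$) one node for each residue class mod $2^l$ that meets $J$; the children of a node at level $l<M$ are the nodes at level $l+1$ whose classes are contained in its class. A level $l$ is a *pivot* of $J$ if some node at level $l$ has two children. A nonempty set $J$ is *homogeneous* if it has exactly $\log_2|J|$ pivots. **Stochastic families.** A stochastic family $(\mathcal J_N,k_N)_N$ consists of integers $k_N\to\infty$ and probability distributions $\mathcal J_N$ on the subsets of $\mathbb Z_N$ such that, for some constants $\alpha,\beta>0$, a random $J\sim\mathcal J_N$ satisfies $\alpha k_N\le|J|\le\beta k_N$ with probability tending to $1$ as $N\to\infty$. For $K\subseteq\mathbb Z_N$ and $k\le|K|$ let $K^{\downarrow k}$ be the distribution of the random subset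 of $K$ that contains each element of $K$ independently with probability $k/|K|$. **Algorithms.** An algorithm is a single program for a random access machine (the same program for all $N$) whose memory cells hold words of $O(\log N)$ bits or complex numbers and are addressed by pairs of words. The program may use word operations, branching and looping on words, exact complex arithmetic (without tests on complex numbers and without division by zero), words read as complex numbers, the roots of unity $e^{-2\pi i x/N}$ ($x$ a word), and, for each $N$, a table of words (addressed by pairs of words) prepared in advance from the family, before $J$ and $f$ are given. It has read access to $|J|$, to a list of the elements of $J$ in arbitrary order, and to the entries of $f$. Every operation, lookup, assignment and test costs one unit. The algorithm computes the DFT coefficients on $J$ with $T$ operations if, for every order in which $J$ is listed and every $f\in\mathbb B^J$, it halts after at most $T$ operations with the exact values $\mathcal F f(j)$, $j\in J$, as output. A stochastic family $(\mathcal J_N,k_N)$ is *Fourier-computable* if there are an algorithm and a constant $c>0$ such that, with probability tending to $1$ over $J\sim\mathcal J_N$ as $N\to\infty$, the algorithm computes the DFT coefficients on $J$ with at most $c\,k_N\log_2 k_N$ operations. **Theorem.** Let $K_N\subseteq\mathbb Z_N$ be homogeneous sets, and let $k_N\le|K_N|$ be natural numbers with $k_N\to\infty$. Then $(K_N^{\downarrow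 k_N},k_N)$ is a stochastic family and it is Fourier-computable. -/

import Mathlib

open Filter Topology MeasureTheory ProbabilityTheory
open scoped ZMod unitInterval

/-! ## Congruence trees, pivots and homogeneous sets

The index set is `ZMod (2 ^ M)`, whose elements are identified with `0, …, 2 ^ M - 1`. -/

/-- The label of the node `r` (with `r < 2 ^ l`) at level `l` of the congruence tree of `J`: the
elements of `J` that leave the remainder `r` on division by `2 ^ l`. The node belongs to the tree
when this label is nonempty. -/
def nodeLabel {M : ℕ} (J : Finset (ZMod (2 ^ M))) (l r : ℕ) : Finset (ZMod (2 ^ M)) :=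
  J.filter fun j => j.val % 2 ^ l = r

/-- The pivots of `J`: the levels `l` at which some node of the congruence tree has two children.
The two possible children of the node `r` at level `l` are the nodes `r` and `r + 2 ^ l` at level
`l + 1`. -/
def pivots {M : ℕ} (J : Finset (ZMod (2 ^ M))) : Finset ℕ :=
  (Finset.range M).filter fun l =>
    ∃ r < 2 ^ l, (nodeLabel J (l + 1) r).Nonempty ∧ (nodeLabel J (l + 1) (r + 2 ^ l)).Nonempty

/-- `J` is homogeneous if it has exactly `log₂ |J|` pivots. -/
def IsHomogeneous {M : ℕ} (J : Finset (ZMod (2 ^ M))) : Prop :=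
  J.card = 2 ^ (pivots J).card

/-! ## Stochastic families of index sets -/

/-- The law of the random subset of `K` that contains each element of `K` independently with
probability `k / |K|`. -/
noncomputable def randomSubset {α : Type*} (K : Finset α) (k : ℕ) (hk : k ≤ K.card) :
    Measure (Set α) :=
  setBernoulli (K : Set α)
    (⟨(k : ℝ) / K.card, by positivity,
      div_le_one_of_le₀ (by exact_mod_cast hk) (by positivity)⟩ : I)

/-- A stochastic family of index sets, indexed by `M` with `N = 2 ^ M`: laws of random subsets of
`ZMod (2 ^ M)` whose size is `Θ(k M)` with probability tending to `1`, where `k M → ∞`. -/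
def IsStochasticFamily (law : (M : ℕ) → Measure (Set (ZMod (2 ^ M)))) (k : ℕ → ℕ) : Prop :=
  (∀ M, IsProbabilityMeasure (law M)) ∧ Tendsto k atTop atTop ∧
    ∃ α β : ℝ, 0 < α ∧ 0 < β ∧
      Tendsto (fun M => law M {J | α * k M ≤ (J.ncard : ℝ) ∧ (J.ncard : ℝ) ≤ β * k M})
        atTop (𝓝 1)

/-- The signals whose discrete Fourier transform vanishes outside `J`. -/
def Bandlimited {M : ℕ} (J : Set (ZMod (2 ^ M))) : Set (ZMod (2 ^ M) → ℂ) :=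
  {f | ∀ m, m ∉ J → 𝓕 f m = 0}

/-! ## The machine model

A random access machine with two sorts of data: machine words, for the index set, addresses and
control flow, and complex numbers, on which only exact arithmetic can be performed (complex
numbers are neither tested nor turned into words). Each sort has its own memory, with cells
addressed by pairs of words. Every operation, lookup, assignment and test costs one unit. -/

/-- What an execution has read access to: the word length `w`, the number `size` of indices and
their list `index`, a table `table` of precomputed words, and the samples `f` of the signal. -/
structure MachineInput (M : ℕ) where
  w : ℕ
  size : ℕ
  index : ℕ → ℕ
  table : ℕ → ℕ → ℕ
  f : ZMod (2 ^ M) → ℂ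

/-- The contents of the two memories. -/
structure Memory where
  word : ℕ → ℕ → ℕ
  scalar : ℕ → ℕ → ℂ

/-- Expressions for words. -/
inductive WordExpr : Type
  | lit (n : ℕ)
  | size
  | index (i : WordExpr)
  | table (a b : WordExpr)
  | cell (a b : WordExpr)
  | add (x y : WordExpr)
  | sub (x y : WordExpr)
  | mul (x y : WordExpr)
  | div (x y : WordExpr)
  | mod (x y : WordExpr)
  | lt (x y : WordExpr)

/-- The value of a word expression. All words are reduced modulo `2 ^ w`; subtraction is
truncated at zero, `div` is the integer quotient, and `lt` is `1` or `0`. -/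
def WordExpr.eval {M : ℕ} (E : MachineInput M) (s : Memory) : WordExpr → ℕ
  | .lit n => n % 2 ^ E.w
  | .size => E.size % 2 ^ E.w
  | .index i => E.index (i.eval E s) % 2 ^ E.w
  | .table a b => E.table (a.eval E s) (b.eval E s) % 2 ^ E.w
  | .cell a b => s.word (a.eval E s) (b.eval E s) % 2 ^ E.w
  | .add x y => (x.eval E s + y.eval E s) % 2 ^ E.w
  | .sub x y => (x.eval E s - y.eval E s) % 2 ^ E.w
  | .mul x y => (x.eval E s * y.eval E s) % 2 ^ E.w
  | .div x y => (x.eval E s / y.eval E s) % 2 ^ E.w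
  | .mod x y => (x.eval E s % y.eval E s) % 2 ^ E.w
  | .lt x y => (if x.eval E s < y.eval E s then 1 else 0) % 2 ^ E.w

/-- The number of operations needed to evaluate a word expression. -/
def WordExpr.cost : WordExpr → ℕ
  | .lit _ => 1
  | .size => 1
  | .index i => i.cost + 1
  | .table a b => a.cost + b.cost + 1
  | .cell a b => a.cost + b.cost + 1
  | .add x y => x.cost + y.cost + 1
  | .sub x y => x.cost + y.cost + 1
  | .mul x y => x.cost + y.cost + 1
  | .div x y => x.cost + y.cost + 1
  | .mod x y => x.cost + y.cost + 1
  | .lt x y => x.cost + y.cost + 1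

/-- Expressions for complex numbers: a word read as a number, a root of unity, a sample of the
signal, a memory cell, and the four arithmetic operations. -/
inductive ScalarExpr : Type
  | ofWord (x : WordExpr)
  | root (x : WordExpr)
  | sample (x : WordExpr)
  | cell (a b : WordExpr)
  | add (x y : ScalarExpr)
  | sub (x y : ScalarExpr)
  | mul (x y : ScalarExpr)
  | div (x y : ScalarExpr)

/-- The value of a complex expression; `root x` is `exp (-2πix / N)` with `N = 2 ^ M`. -/
noncomputable def ScalarExpr.eval {M : ℕ} (E : MachineInput M) (s : Memory) : ScalarExpr → ℂ
  | .ofWord x => (x.eval E s : ℂ)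
  | .root x => Complex.exp (-(2 * Real.pi * Complex.I * (x.eval E s : ℂ) / (2 : ℂ) ^ M))
  | .sample x => E.f ((x.eval E s : ℕ) : ZMod (2 ^ M))
  | .cell a b => s.scalar (a.eval E s) (b.eval E s)
  | .add x y => x.eval E s + y.eval E s
  | .sub x y => x.eval E s - y.eval E s
  | .mul x y => x.eval E s * y.eval E s
  | .div x y => x.eval E s / y.eval E s

/-- No division by zero occurs in the evaluation of a complex expression. -/
def ScalarExpr.Defined {M : ℕ} (E : MachineInput M) (s : Memory) : ScalarExpr → Prop
  | .ofWord _ => True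
  | .root _ => True
  | .sample _ => True
  | .cell _ _ => True
  | .add x y => x.Defined E s ∧ y.Defined E s
  | .sub x y => x.Defined E s ∧ y.Defined E s
  | .mul x y => x.Defined E s ∧ y.Defined E s
  | .div x y => x.Defined E s ∧ y.Defined E s ∧ y.eval E s ≠ 0

/-- The number of operations needed to evaluate a complex expression. -/
def ScalarExpr.cost : ScalarExpr → ℕ
  | .ofWord x => x.cost + 1
  | .root x => x.cost + 1
  | .sample x => x.cost + 1
  | .cell a b => a.cost + b.cost + 1
  | .add x y => x.cost + y.cost + 1
  | .sub x y => x.cost + y.cost + 1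
  | .mul x y => x.cost + y.cost + 1
  | .div x y => x.cost + y.cost + 1

/-- Programs. -/
inductive Program : Type
  | skip
  | setWord (a b : WordExpr) (x : WordExpr)
  | setScalar (a b : WordExpr) (x : ScalarExpr)
  | seq (p q : Program)
  | cond (x : WordExpr) (p q : Program)
  | loop (x : WordExpr) (p : Program)

/-- Overwrite the word in the cell `(a, b)`. -/
def Memory.setWord (s : Memory) (a b v : ℕ) : Memory :=
  { s with word := Function.update s.word a (Function.update (s.word a) b v) }

/-- Overwrite the complex number in the cell `(a, b)`. -/
noncomputable def Memory.setScalar (s : Memory) (a b : ℕ) (v : ℂ) : Memory :=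
  { s with scalar := Function.update s.scalar a (Function.update (s.scalar a) b v) }

/-- `Exec E p s t s'`: started with memory `s`, the program `p` halts after exactly `t` operations
with memory `s'`. The program `cond x p q` runs `p` if `x ≠ 0` and `q` otherwise; `loop x p`
repeats `p` as long as `x ≠ 0`. -/
inductive Exec {M : ℕ} (E : MachineInput M) : Program → Memory → ℕ → Memory → Prop
  | skip (s : Memory) : Exec E .skip s 1 s
  | setWord (a b x : WordExpr) (s : Memory) :
      Exec E (.setWord a b x) s (a.cost + b.cost + x.cost + 1)
        (s.setWord (a.eval E s) (b.eval E s) (x.eval E s))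
  | setScalar (a b : WordExpr) (x : ScalarExpr) (s : Memory) (hx : x.Defined E s) :
      Exec E (.setScalar a b x) s (a.cost + b.cost + x.cost + 1)
        (s.setScalar (a.eval E s) (b.eval E s) (x.eval E s))
  | seq {p q : Program} {s s' s'' : Memory} {t u : ℕ} (hp : Exec E p s t s')
      (hq : Exec E q s' u s'') : Exec E (.seq p q) s (t + u) s''
  | condTrue {x : WordExpr} {p q : Program} {s s' : Memory} {t : ℕ} (hx : x.eval E s ≠ 0)
      (hp : Exec E p s t s') : Exec E (.cond x p q) s (x.cost + 1 + t) s'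
  | condFalse {x : WordExpr} {p q : Program} {s s' : Memory} {t : ℕ} (hx : x.eval E s = 0)
      (hq : Exec E q s t s') : Exec E (.cond x p q) s (x.cost + 1 + t) s'
  | loopTrue {x : WordExpr} {p : Program} {s s' s'' : Memory} {t u : ℕ} (hx : x.eval E s ≠ 0)
      (hp : Exec E p s t s') (hl : Exec E (.loop x p) s' u s'') :
      Exec E (.loop x p) s (x.cost + 1 + t + u) s''
  | loopFalse {x : WordExpr} {p : Program} {s : Memory} (hx : x.eval E s = 0) :
      Exec E (.loop x p) s (x.cost + 1) s

/-! ## Structured-DFT algorithms and Fourier computability -/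

/-- An algorithm: one program for all `N = 2 ^ M`, together with, for each `N`, a table of words
that is prepared in advance (before the index set and the signal are given). The word length is
`wordFactor * (M + 1) = O(log N)`; the part of the table that can be addressed thus has a size
polynomial in `N`. -/
structure StructuredDFT where
  program : Program
  table : ℕ → ℕ → ℕ → ℕ
  wordFactor : ℕ

/-- The input of `A` when the elements of `J` are listed as `e 0, …, e (n - 1)`. -/
def StructuredDFT.input (A : StructuredDFT) {M n : ℕ} {J : Set (ZMod (2 ^ M))} (e : Fin n ≃ J)
    (f : ZMod (2 ^ M) → ℂ) : MachineInput M where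
  w := A.wordFactor * (M + 1)
  size := n
  index := fun i => if h : i < n then (e ⟨i, h⟩ : ZMod (2 ^ M)).val else 0
  table := A.table M
  f := f

/-- The memory in which all cells are zero. -/
noncomputable def Memory.init : Memory := ⟨fun _ _ => 0, fun _ _ => 0⟩

/-- `A` computes the DFT coefficients on `J` with at most `T` operations: whatever the order in
which the elements of `J` are listed, and for every signal `f` with frequency support in `J`, the
program halts after at most `T` operations with the coefficient at the `i`-th listed index in the
complex memory cell `(0, i)`. -/
def StructuredDFT.ComputesWithin (A : StructuredDFT) {M : ℕ} (J : Set (ZMod (2 ^ M))) (T : ℝ) :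
    Prop :=
  ∀ (n : ℕ) (e : Fin n ≃ J), ∀ f ∈ Bandlimited J,
    ∃ (t : ℕ) (s : Memory), Exec (A.input e f) A.program Memory.init t s ∧ (t : ℝ) ≤ T ∧
      ∀ i : Fin n, s.scalar 0 i = 𝓕 f (e i : ZMod (2 ^ M))

/-- On the stochastic family `law`, the algorithm has complexity `O(g)`: for some constant `c`,
the DFT coefficients are computed with at most `c * g M` operations with a probability (over the
index set) that tends to `1`. -/
def StructuredDFT.HasComplexity (A : StructuredDFT) (law : (M : ℕ) → Measure (Set (ZMod (2 ^ M))))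
    (g : ℕ → ℝ) : Prop :=
  ∃ c : ℝ, 0 < c ∧ Tendsto (fun M => law M {J | A.ComputesWithin J (c * g M)}) atTop (𝓝 1)

/-- A stochastic family is Fourier-computable if some algorithm has complexity `O(k log k)`
on it. -/
def FourierComputable (law : (M : ℕ) → Measure (Set (ZMod (2 ^ M)))) (k : ℕ → ℕ) : Prop :=
  ∃ A : StructuredDFT, A.HasComplexity law fun M => k M * Real.logb 2 (k M)

/-! ## Counted loops -/

/-! Two elements of a set that first differ in the binary digit `l` make `l` a pivot, so an element
is determined by its digits at the pivots. If there are `P` pivots and `2 ^ P` elements, every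
pattern of pivot digits occurs, and the congruence tree is a full binary tree with unary stretches
inserted (`exists_treeEnumeration`). On such a tree the FFT works as on the full index set. Let `l`
be the next pivot and `h = 2 ^ (M - 1 - l)`. The frequencies of one node agree modulo `2 ^ l`, so a
shift by `h` multiplies each of their exponentials by one common phase times a sign given by digit
`l`. One multiplication and one addition therefore yield a sample of a child's component from two
samples of the parent's (`TreeEnumeration.nodeSum_succ`). The twiddle factors and sample points
depend on `K` alone, hence fit into the prepared table.

Descending through all `P` pivots would cost about `|K| log |K|`, which can be far more than `k log
k`. The descent instead stops after `m` pivots, where `2 ^ m` is of order `k / log k`. Each of the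
`2 ^ m` nodes then has expected load at most `2 log k`. By an exponential Markov bound
(`randomSubset_upper_tail`) and a union bound, with high probability no node receives more than `S =
5 log k` elements of `J` (`randomSubset_overfull`). Here `log` is the integer base-2 logarithm.

A node's component is then an exponential sum with at most `S` frequencies, known at `S` consecutive
points: a Vandermonde system. For the frequency `j` the polynomial that vanishes at the other
frequencies of the node isolates its coefficient (`vandermonde_solution`). It is the node polynomial
divided by one linear factor, so each frequency costs `O(S)` operations. The butterflies cost `O(m 2
^ m S)` and the systems `O(2 ^ m S ^ 2)`, both `O(k log k)`. `halts_dftProgram` does this accounting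
on the machine, and `TreeEnumeration.computesWithin` joins it to the mathematics. -/

/-- The word in the cell `(0, c)`, used as a loop counter. -/
def WordExpr.counter (c : ℕ) : WordExpr := .cell (.lit 0) (.lit c)

/-- Run `body` with the counter `c` going from `0` to `bound - 1`. -/
def Program.forLoop (c : ℕ) (bound : WordExpr) (body : Program) : Program :=
  .seq (.setWord (.lit 0) (.lit c) (.lit 0))
    (.loop (.lt (.counter c) bound)
      (.seq body (.setWord (.lit 0) (.lit c) (.add (.counter c) (.lit 1)))))

/-! ### Evaluation of expressions and rules for execution. -/

section Machine

variable {M : ℕ} {E : MachineInput M}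

@[simp] lemma Memory.setWord_scalar (s : Memory) (a b v : ℕ) :
    (s.setWord a b v).scalar = s.scalar := rfl

@[simp] lemma Memory.setScalar_word (s : Memory) (a b : ℕ) (v : ℂ) :
    (s.setScalar a b v).word = s.word := rfl

lemma Memory.setWord_word (s : Memory) (a b v x y : ℕ) :
    (s.setWord a b v).word x y = if x = a ∧ y = b then v else s.word x y := by
  simp only [Memory.setWord, Function.update_apply]
  split_ifs <;> simp_all

lemma Memory.setScalar_scalar (s : Memory) (a b : ℕ) (v : ℂ) (x y : ℕ) :
    (s.setScalar a b v).scalar x y = if x = a ∧ y = b then v else s.scalar x y := by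
  simp only [Memory.setScalar, Function.update_apply]
  split_ifs <;> simp_all

lemma WordExpr.eval_lit {n : ℕ} (hn : n < 2 ^ E.w) (s : Memory) :
    (WordExpr.lit n).eval E s = n := Nat.mod_eq_of_lt hn

lemma WordExpr.eval_counter {c : ℕ} (hc : c < 2 ^ E.w) {s : Memory} {g : ℕ}
    (h : s.word 0 c = g) (hg : g < 2 ^ E.w) : (WordExpr.counter c).eval E s = g := by
  simp [WordExpr.counter, WordExpr.eval, Nat.mod_eq_of_lt hc, h, Nat.mod_eq_of_lt hg]

lemma WordExpr.eval_add {x y : WordExpr} {s : Memory} {a b : ℕ} (hx : x.eval E s = a)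
    (hy : y.eval E s = b) (h : a + b < 2 ^ E.w) : (WordExpr.add x y).eval E s = a + b := by
  simp [WordExpr.eval, hx, hy, Nat.mod_eq_of_lt h]

lemma WordExpr.eval_sub {x y : WordExpr} {s : Memory} {a b : ℕ} (hx : x.eval E s = a)
    (hy : y.eval E s = b) (h : a < 2 ^ E.w) : (WordExpr.sub x y).eval E s = a - b := by
  simp [WordExpr.eval, hx, hy, Nat.mod_eq_of_lt ((Nat.sub_le a b).trans_lt h)]

lemma WordExpr.eval_table {x y : WordExpr} {s : Memory} {a b : ℕ} (hx : x.eval E s = a)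
    (hy : y.eval E s = b) (h : E.table a b < 2 ^ E.w) :
    (WordExpr.table x y).eval E s = E.table a b := by
  simp [WordExpr.eval, hx, hy, Nat.mod_eq_of_lt h]

lemma WordExpr.eval_index {x : WordExpr} {s : Memory} {a : ℕ} (hx : x.eval E s = a)
    (h : E.index a < 2 ^ E.w) : (WordExpr.index x).eval E s = E.index a := by
  simp [WordExpr.eval, hx, Nat.mod_eq_of_lt h]

/-- `p` started in `s` halts within `T` operations in a memory with property `Q`. -/
def Halts (E : MachineInput M) (p : Program) (s : Memory) (T : ℕ) (Q : Memory → Prop) : Prop :=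
  ∃ t s', Exec E p s t s' ∧ t ≤ T ∧ Q s'

lemma Halts.mono {p : Program} {s : Memory} {T T' : ℕ} {Q Q' : Memory → Prop}
    (h : Halts E p s T Q) (hT : T ≤ T') (hQ : ∀ s', Q s' → Q' s') : Halts E p s T' Q' := by
  obtain ⟨t, s', he, ht, hq⟩ := h
  exact ⟨t, s', he, ht.trans hT, hQ _ hq⟩

lemma Halts.seq {p q : Program} {s : Memory} {T U : ℕ} {Q R : Memory → Prop}
    (hp : Halts E p s T Q) (hq : ∀ s', Q s' → Halts E q s' U R) :
    Halts E (.seq p q) s (T + U) R := by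
  obtain ⟨t, s', he, ht, hs⟩ := hp
  obtain ⟨u, s'', he', hu, hs'⟩ := hq s' hs
  exact ⟨t + u, s'', .seq he he', by omega, hs'⟩

lemma halts_setScalar {a b : WordExpr} {x : ScalarExpr} {s : Memory} {i j : ℕ} {v : ℂ}
    {Q : Memory → Prop} (ha : a.eval E s = i) (hb : b.eval E s = j) (hd : x.Defined E s)
    (hx : x.eval E s = v) (hQ : Q (s.setScalar i j v)) :
    Halts E (.setScalar a b x) s (a.cost + b.cost + x.cost + 1) Q :=
  ⟨_, _, .setScalar a b x s hd, le_rfl, by rwa [ha, hb, hx]⟩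

/-- The rule for counted loops. -/
lemma halts_forLoop {c : ℕ} {bound : WordExpr} {body : Program} {s : Memory} {n T : ℕ}
    (Inv : ℕ → Memory → Prop) (hw : 1 < 2 ^ E.w) (hc : c < 2 ^ E.w) (hn : n < 2 ^ E.w)
    (hbound : ∀ s, bound.eval E s = n) (h0 : Inv 0 (s.setWord 0 c 0))
    (hbody : ∀ g < n, ∀ s, Inv g s → s.word 0 c = g →
      Halts E body s T fun s' => s'.word 0 c = g ∧ Inv (g + 1) (s'.setWord 0 c (g + 1))) :
    Halts E (.forLoop c bound body) s (n * (T + bound.cost + 13) + bound.cost + 9) (Inv n) := by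
  have hz : 0 < 2 ^ E.w := by positivity
  -- Induction on the number `r` of remaining rounds. A round costs `bound.cost + 5` for the test,
  -- `T` for the body and `8` for the increment; the last, failing test is the additive term.
  have key : ∀ r g s, g + r = n → Inv g s → s.word 0 c = g →
      Halts E (.loop (.lt (.counter c) bound)
      (.seq body (.setWord (.lit 0) (.lit c) (.add (.counter c) (.lit 1))))) s
        (r * (T + bound.cost + 13) + bound.cost + 5) (Inv n) := by
    intro r
    induction r with
    | zero =>
      intro g s hg hi hs
      have hev : (WordExpr.lt (.counter c) bound).eval E s = 0 := by
        simp [WordExpr.eval, hbound, WordExpr.eval_counter hc hs (by omega)]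
        rw [if_neg (by omega), Nat.zero_mod]
      refine ⟨_, _, .loopFalse hev, ?_, ?_⟩
      · simp [WordExpr.cost, WordExpr.counter]; omega
      · rw [← hg]; exact hi
    | succ r ih =>
      intro g s hg hi hs
      have hev : (WordExpr.lt (.counter c) bound).eval E s ≠ 0 := by
        simp [WordExpr.eval, hbound, WordExpr.eval_counter hc hs (by omega)]
        rw [if_pos (by omega), Nat.mod_eq_of_lt hw]; simp
      obtain ⟨t, s', he, ht, hs', hi'⟩ := hbody g (by omega) s hi hs
      obtain ⟨u, s'', he', hu, hs''⟩ := ih (g + 1) (s'.setWord 0 c (g + 1)) (by omega) hi'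
        (by simp [Memory.setWord_word])
      have h2 : Exec E (.setWord (.lit 0) (.lit c) (.add (.counter c) (.lit 1))) s' 8
          (s'.setWord 0 c (g + 1)) := by
        have := Exec.setWord (E := E) (.lit 0) (.lit c) (.add (.counter c) (.lit 1)) s'
        rwa [WordExpr.eval_lit hz, WordExpr.eval_lit hc,
          WordExpr.eval_add (WordExpr.eval_counter hc hs' (by omega)) (WordExpr.eval_lit hw _)
            (by omega)] at this
      refine ⟨_, _, .loopTrue hev (.seq he h2) he', ?_, hs''⟩
      simp only [WordExpr.cost, WordExpr.counter]
      linarith [add_mul r 1 (T + bound.cost + 13)]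
  have h1 : Halts E (.setWord (.lit 0) (.lit c) (.lit 0)) s 4
      (fun s' => s' = s.setWord 0 c 0) := by
    refine ⟨_, _, Exec.setWord _ _ _ _, le_rfl, ?_⟩
    rw [WordExpr.eval_lit hz, WordExpr.eval_lit hc]
  refine (h1.seq (U := n * (T + bound.cost + 13) + bound.cost + 5) ?_).mono (by omega)
    fun _ h => h
  rintro _ rfl
  exact key n 0 _ (by omega) h0 (by simp [Memory.setWord_word])

end Machine

/-! ## The program -/

/-- Read the samples listed in row `1` of the table. -/
def sampling : Program :=
  .forLoop 0 (.table (.lit 0) (.lit 0))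
    (.setScalar (.lit 1) (.counter 0) (.sample (.table (.lit 1) (.counter 0))))

/-- Perform the butterflies listed in rows `2`, `3`, `4` of the table. -/
def butterflies : Program :=
  .forLoop 0 (.table (.lit 0) (.lit 2))
    (.setScalar (.lit 1) (.add (.table (.lit 0) (.lit 0)) (.counter 0))
      (.add (.cell (.lit 1) (.table (.lit 2) (.counter 0)))
        (.mul (.root (.table (.lit 3) (.counter 0)))
          (.cell (.lit 1) (.table (.lit 4) (.counter 0))))))

/-- Initialize the node polynomials by `1`. -/
def initPolynomials : Program :=
  .forLoop 0 (.table (.lit 0) (.lit 1))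
    (.setScalar (.add (.counter 0) (.lit 3)) (.lit 1) (.ofWord (.lit 1)))

/-- The address of the row of the polynomial belonging to the `i`-th listed index. -/
def polyRow : WordExpr :=
  .add (.table (.lit 5) (.index (.counter 0))) (.lit 3)

/-- Multiply each node polynomial by the factors `1 - z X` of the listed indices of the node. -/
def multiplyPolynomials : Program :=
  .forLoop 0 .size (.forLoop 1 (.table (.lit 0) (.lit 3))
    (.setScalar polyRow (.sub (.table (.lit 0) (.lit 3)) (.counter 1))
      (.sub (.cell polyRow (.sub (.table (.lit 0) (.lit 3)) (.counter 1)))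
        (.mul (.root (.index (.counter 0)))
          (.cell polyRow (.sub (.sub (.table (.lit 0) (.lit 3)) (.counter 1)) (.lit 1)))))))

/-- The cell `(2, c)` for complex numbers. -/
def ScalarExpr.temp (c : ℕ) : ScalarExpr := .cell (.lit 2) (.lit c)

/-- Extract the coefficients from the node samples. -/
def extraction : Program :=
  .forLoop 0 .size
    (.seq (.setScalar (.lit 2) (.lit 0) (.ofWord (.lit 0)))
    (.seq (.setScalar (.lit 2) (.lit 1) (.ofWord (.lit 0)))
    (.seq (.setScalar (.lit 2) (.lit 2) (.ofWord (.lit 0)))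
    (.seq (.forLoop 1 (.table (.lit 0) (.lit 3))
      (.seq (.setScalar (.lit 2) (.lit 0) (.add (.cell polyRow (.add (.counter 1) (.lit 1)))
          (.mul (.root (.index (.counter 0))) (.temp 0))))
      (.seq (.setScalar (.lit 2) (.lit 1) (.add (.temp 1) (.mul (.temp 0)
          (.cell (.lit 1) (.add (.table (.lit 6) (.index (.counter 0))) (.counter 1))))))
        (.setScalar (.lit 2) (.lit 2) (.add (.mul (.temp 2) (.root (.index (.counter 0))))
          (.temp 0))))))
    (.setScalar (.lit 0) (.counter 0) (.mul (.div (.temp 1) (.temp 2))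
      (.ofWord (.table (.lit 0) (.lit 4)))))))))

/-- The DFT program: butterflies down to the nodes of a fixed level, followed by the solution of
one Vandermonde system per node. -/
def dftProgram : Program :=
  .seq sampling (.seq butterflies (.seq initPolynomials (.seq multiplyPolynomials extraction)))

/-! ### Effect and cost of each phase of the program. -/

section Machine

variable {M : ℕ} {E : MachineInput M}

/-- The root of unity with exponent `-x / 2 ^ M`. -/
noncomputable def unityRoot (M x : ℕ) : ℂ :=
  Complex.exp (-(2 * Real.pi * Complex.I * (x : ℂ) / (2 : ℂ) ^ M))

/-- All entries of the table are words, and there is room for the small literals. -/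
structure MachineInput.Fits (E : MachineInput M) : Prop where
  lit : 32 ≤ 2 ^ E.w
  table : ∀ a b, E.table a b < 2 ^ E.w
  index : ∀ i, E.index i < 2 ^ E.w
  size : E.size < 2 ^ E.w

lemma MachineInput.Fits.evalLit (hE : E.Fits) {n : ℕ} (hn : n < 32) (s : Memory) :
    (WordExpr.lit n).eval E s = n := WordExpr.eval_lit (hn.trans_le hE.lit) s

lemma MachineInput.Fits.evalTable (hE : E.Fits) {x y : WordExpr} {s : Memory} {a b : ℕ}
    (hx : x.eval E s = a) (hy : y.eval E s = b) :
    (WordExpr.table x y).eval E s = E.table a b := WordExpr.eval_table hx hy (hE.table a b)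

lemma MachineInput.Fits.evalIndex (hE : E.Fits) {x : WordExpr} {s : Memory} {a : ℕ}
    (hx : x.eval E s = a) : (WordExpr.index x).eval E s = E.index a :=
  WordExpr.eval_index hx (hE.index a)

lemma MachineInput.Fits.evalConst (hE : E.Fits) {a b : ℕ} (ha : a < 32) (hb : b < 32)
    (s : Memory) : (WordExpr.table (.lit a) (.lit b)).eval E s = E.table a b :=
  hE.evalTable (hE.evalLit ha s) (hE.evalLit hb s)

lemma MachineInput.Fits.evalSize (hE : E.Fits) (s : Memory) :
    WordExpr.size.eval E s = E.size := Nat.mod_eq_of_lt hE.size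

lemma MachineInput.Fits.evalCounter (hE : E.Fits) {c : ℕ} (hc : c < 32) {s : Memory} {g : ℕ}
    (h : s.word 0 c = g) (hg : g < 2 ^ E.w) : (WordExpr.counter c).eval E s = g :=
  WordExpr.eval_counter (hc.trans_le hE.lit) h hg

lemma ScalarExpr.eval_cell {a b : WordExpr} {s : Memory} {i j : ℕ}
    (ha : a.eval E s = i) (hb : b.eval E s = j) :
    (ScalarExpr.cell a b).eval E s = s.scalar i j := by
  simp [ScalarExpr.eval, ha, hb]

lemma ScalarExpr.eval_root {a : WordExpr} {s : Memory} {i : ℕ} (ha : a.eval E s = i) :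
    (ScalarExpr.root a).eval E s = unityRoot M i := by
  simp [ScalarExpr.eval, ha, unityRoot]

lemma ScalarExpr.eval_add {x y : ScalarExpr} {s : Memory} {u v : ℂ}
    (hx : x.eval E s = u) (hy : y.eval E s = v) : (ScalarExpr.add x y).eval E s = u + v := by
  simp [ScalarExpr.eval, hx, hy]

lemma ScalarExpr.eval_sub {x y : ScalarExpr} {s : Memory} {u v : ℂ}
    (hx : x.eval E s = u) (hy : y.eval E s = v) : (ScalarExpr.sub x y).eval E s = u - v := by
  simp [ScalarExpr.eval, hx, hy]

lemma ScalarExpr.eval_mul {x y : ScalarExpr} {s : Memory} {u v : ℂ}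
    (hx : x.eval E s = u) (hy : y.eval E s = v) : (ScalarExpr.mul x y).eval E s = u * v := by
  simp [ScalarExpr.eval, hx, hy]

lemma ScalarExpr.eval_div {x y : ScalarExpr} {s : Memory} {u v : ℂ}
    (hx : x.eval E s = u) (hy : y.eval E s = v) : (ScalarExpr.div x y).eval E s = u / v := by
  simp [ScalarExpr.eval, hx, hy]

lemma ScalarExpr.eval_temp (hE : E.Fits) {c : ℕ} (hc : c < 32) (s : Memory) :
    (ScalarExpr.temp c).eval E s = s.scalar 2 c :=
  ScalarExpr.eval_cell (hE.evalLit (by norm_num) s) (hE.evalLit hc s)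

lemma ScalarExpr.eval_ofLit (hE : E.Fits) {n : ℕ} (hn : n < 32) (s : Memory) :
    (ScalarExpr.ofWord (.lit n)).eval E s = n := by
  simp [ScalarExpr.eval, hE.evalLit hn s]

lemma halts_sampling (hE : E.Fits) {V : ℕ → ℂ}
    (hV : ∀ q < E.table 0 0, V q = E.f (E.table 1 q)) (s : Memory) :
    Halts E sampling s (E.table 0 0 * 30 + 12) fun s' =>
      (∀ r ≠ 1, s'.scalar r = s.scalar r) ∧ ∀ q < E.table 0 0, s'.scalar 1 q = V q := by
  refine (halts_forLoop (n := E.table 0 0) (T := 12) (fun g s' =>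
    (∀ r ≠ 1, s'.scalar r = s.scalar r) ∧ ∀ q < g, s'.scalar 1 q = V q)
    (by linarith [hE.lit]) (by linarith [hE.lit]) (hE.table 0 0)
    (hE.evalConst (by norm_num) (by norm_num)) (by simp) ?_).mono
    (by simp only [WordExpr.cost]; omega) fun s' h => h
  rintro g hg s' ⟨h1, h2⟩ hs'
  have hgw := hg.trans (hE.table 0 0)
  have hc := hE.evalCounter (c := 0) (by norm_num) hs' hgw
  refine (halts_setScalar (i := 1) (j := g) (v := V g)
    (hE.evalLit (by norm_num) _) hc (by trivial) ?_ ?_).mono ?_ fun _ h => h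
  · simp [ScalarExpr.eval, hE.evalTable (hE.evalLit (n := 1) (by norm_num) s') hc, hV g hg]
  · refine ⟨hs', fun r hr => ?_, fun q hq => ?_⟩
    · ext x
      simp [Memory.setScalar_scalar, hr, h1 r hr]
    · simp only [Memory.setWord_scalar, Memory.setScalar_scalar, true_and]
      split_ifs with h
      · rw [h]
      · exact h2 q (by omega)
  · simp [ScalarExpr.cost, WordExpr.cost, WordExpr.counter]

/-- The values form a straight-line computation: `h2` and `h4` say that the operands of every
butterfly stand earlier in the list, so they are already in memory when it is executed. -/
lemma halts_butterflies (hE : E.Fits) {V : ℕ → ℂ}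
    (hw : E.table 0 0 + E.table 0 2 < 2 ^ E.w)
    (h2 : ∀ g < E.table 0 2, E.table 2 g < E.table 0 0 + g)
    (h4 : ∀ g < E.table 0 2, E.table 4 g < E.table 0 0 + g)
    (hV : ∀ g < E.table 0 2, V (E.table 0 0 + g) =
      V (E.table 2 g) + unityRoot M (E.table 3 g) * V (E.table 4 g)) (s : Memory)
    (hs : ∀ q < E.table 0 0, s.scalar 1 q = V q) :
    Halts E butterflies s (E.table 0 2 * 50 + 12) fun s' =>
      (∀ r ≠ 1, s'.scalar r = s.scalar r) ∧
        ∀ q < E.table 0 0 + E.table 0 2, s'.scalar 1 q = V q := by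
  refine (halts_forLoop (n := E.table 0 2) (T := 34) (fun g s' =>
    (∀ r ≠ 1, s'.scalar r = s.scalar r) ∧ ∀ q < E.table 0 0 + g, s'.scalar 1 q = V q)
    (by linarith [hE.lit]) (by linarith [hE.lit]) (hE.table 0 2)
    (hE.evalConst (by norm_num) (by norm_num)) (by simpa using hs) ?_).mono
    (by simp only [WordExpr.cost]; omega) fun s' h => h
  rintro g hg s' ⟨hr1, hr2⟩ hs'
  have hgw := hg.trans (hE.table 0 2)
  have hc := hE.evalCounter (c := 0) (by norm_num) hs' hgw
  have hl : ∀ n < 32, (WordExpr.lit n).eval E s' = n := fun n hn => hE.evalLit hn s'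
  refine (halts_setScalar (i := 1) (j := E.table 0 0 + g) (v := V (E.table 0 0 + g))
    (hl 1 (by norm_num)) (WordExpr.eval_add (hE.evalConst (by norm_num) (by norm_num) s') hc
      (by omega)) (by simp [ScalarExpr.Defined]) ?_ ?_).mono ?_ fun _ h => h
  · rw [hV g hg, ← hr2 _ (h2 g hg), ← hr2 _ (h4 g hg)]
    exact ScalarExpr.eval_add (ScalarExpr.eval_cell (hl 1 (by norm_num))
      (hE.evalTable (hl 2 (by norm_num)) hc)) (ScalarExpr.eval_mul
      (ScalarExpr.eval_root (hE.evalTable (hl 3 (by norm_num)) hc))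
      (ScalarExpr.eval_cell (hl 1 (by norm_num)) (hE.evalTable (hl 4 (by norm_num)) hc)))
  · refine ⟨hs', fun r hr => ?_, fun q hq => ?_⟩
    · ext x
      simp [Memory.setScalar_scalar, hr, hr1 r hr]
    · simp only [Memory.setWord_scalar, Memory.setScalar_scalar, true_and]
      split_ifs with h
      · rw [h]
      · exact hr2 q (by omega)
  · simp [ScalarExpr.cost, WordExpr.cost, WordExpr.counter]

/-- Coefficients are stored with an offset of one, behind a zero cell, so the polynomial `1` is the
row `Pi.single 1 1`. Writing one cell per row suffices because the rows start out zero. -/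
lemma halts_initPolynomials (hE : E.Fits) (hw : E.table 0 1 + 3 < 2 ^ E.w) (s : Memory)
    (hs : ∀ r, s.scalar (r + 3) = 0) :
    Halts E initPolynomials s (E.table 0 1 * 30 + 12) fun s' =>
      (∀ r < 3, s'.scalar r = s.scalar r) ∧
        ∀ b < E.table 0 1, s'.scalar (b + 3) = Pi.single 1 1 := by
  refine (halts_forLoop (n := E.table 0 1) (T := 12) (fun g s' =>
    (∀ r < 3, s'.scalar r = s.scalar r) ∧
      (∀ b < g, s'.scalar (b + 3) = Pi.single 1 1) ∧ ∀ b ≥ g, s'.scalar (b + 3) = 0)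
    (by linarith [hE.lit]) (by linarith [hE.lit]) (hE.table 0 1)
    (hE.evalConst (by norm_num) (by norm_num)) (by simpa using hs) ?_).mono
    (by simp only [WordExpr.cost]; omega) fun s' h => ⟨h.1, h.2.1⟩
  rintro g hg s' ⟨hr1, hr2, hr3⟩ hs'
  have hgw := hg.trans (hE.table 0 1)
  have hc := hE.evalCounter (c := 0) (by norm_num) hs' hgw
  have hl : ∀ n < 32, (WordExpr.lit n).eval E s' = n := fun n hn => hE.evalLit hn s'
  refine (halts_setScalar (i := g + 3) (j := 1) (v := 1)
    (WordExpr.eval_add hc (hl 3 (by norm_num)) (by omega)) (hl 1 (by norm_num)) (by trivial)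
    (by simpa using ScalarExpr.eval_ofLit hE (n := 1) (by norm_num) s') ?_).mono ?_
    fun _ h => h
  · refine ⟨hs', fun r hr => ?_, fun q hq => ?_, fun q hq => ?_⟩
    · ext x
      simp [Memory.setScalar_scalar, (show r ≠ g + 3 by omega), hr1 r hr]
    · ext x
      simp only [Memory.setWord_scalar, Memory.setScalar_scalar, Nat.add_right_cancel_iff]
      rcases (Nat.lt_succ_iff_lt_or_eq.1 hq) with h | rfl
      · simp [h.ne, hr2 q h]
      · simp [hr3 q le_rfl, Pi.single_apply]
    · ext x
      simp [Memory.setScalar_scalar, (show q ≠ g by omega), hr3 q (by omega)]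
  · simp [ScalarExpr.cost, WordExpr.cost, WordExpr.counter]

/-- The contents of the row of a polynomial: a zero, followed by the coefficients. -/
noncomputable def polyCells (p : Polynomial ℂ) : ℕ → ℂ
  | 0 => 0
  | t + 1 => p.coeff t

/-- The product of the factors `1 - z X` over the first `i` listed indices that lie in node `b`. -/
noncomputable def nodePoly (E : MachineInput M) (i b : ℕ) : Polynomial ℂ :=
  ∏ i' ∈ (Finset.range i).filter fun i' => E.table 5 (E.index i') = b,
    (1 - Polynomial.C (unityRoot M (E.index i')) * Polynomial.X)

lemma nodePoly_succ (i b : ℕ) : nodePoly E (i + 1) b =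
    if E.table 5 (E.index i) = b then
      nodePoly E i b * (1 - Polynomial.C (unityRoot M (E.index i)) * Polynomial.X)
    else nodePoly E i b := by
  unfold nodePoly
  rw [Finset.range_add_one, Finset.filter_insert]
  split_ifs with h
  · rw [Finset.prod_insert (by simp), mul_comm]
  · rfl

/-- The zero in front of the coefficients makes the recurrence uniform: the constant term needs no
separate case, here or in the program. -/
lemma polyCells_mul (p : Polynomial ℂ) (z : ℂ) (t : ℕ) :
    polyCells (p * (1 - Polynomial.C z * Polynomial.X)) (t + 1) =
      polyCells p (t + 1) - z * polyCells p t := by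
  rw [mul_sub, mul_one, ← mul_assoc, mul_comm p (Polynomial.C z), mul_assoc]
  cases t <;> simp [polyCells]

lemma MachineInput.Fits.evalPolyRow (hE : E.Fits) {s : Memory} {g : ℕ} (hs : s.word 0 0 = g)
    (hg : g < 2 ^ E.w) (hw : E.table 5 (E.index g) + 3 < 2 ^ E.w) :
    polyRow.eval E s = E.table 5 (E.index g) + 3 :=
  WordExpr.eval_add (hE.evalTable (hE.evalLit (by norm_num) s)
    (hE.evalIndex (hE.evalCounter (by norm_num) hs hg))) (hE.evalLit (by norm_num) s) hw

/-- The factors are multiplied in place. Only the coefficients below degree `S` are kept, which is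
all that division by a linear factor will need. -/
lemma halts_multiplyPolynomials (hE : E.Fits) (hw : E.table 0 1 + 3 < 2 ^ E.w)
    (h5 : ∀ i < E.size, E.table 5 (E.index i) < E.table 0 1) (s : Memory)
    (hs : ∀ b < E.table 0 1, s.scalar (b + 3) = Pi.single 1 1) :
    Halts E multiplyPolynomials s (E.size * (E.table 0 3 * 80 + 40) + 12) fun s' =>
      (∀ r < 3, s'.scalar r = s.scalar r) ∧ ∀ b < E.table 0 1, ∀ t ≤ E.table 0 3,
        s'.scalar (b + 3) t = polyCells (nodePoly E E.size b) t := by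
  refine (halts_forLoop (n := E.size) (T := E.table 0 3 * 80 + 12) (fun g s' =>
    (∀ r < 3, s'.scalar r = s.scalar r) ∧ ∀ b < E.table 0 1, ∀ t ≤ E.table 0 3,
        s'.scalar (b + 3) t = polyCells (nodePoly E g b) t)
    (by linarith [hE.lit]) (by linarith [hE.lit]) hE.size
    hE.evalSize ?_ ?_).mono ?_ fun s' h => h
  · refine ⟨fun r hr => rfl, fun b hb t ht => ?_⟩
    simp only [Memory.setWord_scalar, hs b hb, nodePoly, Finset.range_zero, Finset.filter_empty,
      Finset.prod_empty]
    rcases t with _ | _ | t <;> simp [polyCells, Polynomial.coeff_one]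
  · rintro g hg s' ⟨hr1, hr2⟩ hs'
    have hgw := hg.trans hE.size
    set S := E.table 0 3 with hS
    set z := unityRoot M (E.index g) with hz
    set b₀ := E.table 5 (E.index g) with hb₀
    have hb₀lt : b₀ < E.table 0 1 := h5 g hg
    -- The row is updated from the top down: after `u` rounds exactly the cells above `S - u` are
    -- new. The update of cell `v + 1` thus still reads the old cell `v`.
    refine (halts_forLoop (n := S) (T := 57) (fun u s'' => s''.word 0 0 = g ∧
      (∀ r < 3, s''.scalar r = s.scalar r) ∧
      (∀ b < E.table 0 1, b ≠ b₀ → ∀ t ≤ S, s''.scalar (b + 3) t = polyCells (nodePoly E g b) t) ∧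
      ∀ t ≤ S, s''.scalar (b₀ + 3) t = if S - u < t then
        polyCells (nodePoly E (g + 1) b₀) t else polyCells (nodePoly E g b₀) t)
      (by linarith [hE.lit]) (by linarith [hE.lit]) (hE.table 0 3)
      (hE.evalConst (by norm_num) (by norm_num)) ?_ ?_).mono ?_ ?_
    · refine ⟨by simpa [Memory.setWord_word] using hs', hr1, fun b hb _ => hr2 b hb,
        fun t ht => ?_⟩
      rw [if_neg (by omega)]
      exact hr2 b₀ hb₀lt t ht
    · rintro u hu s'' ⟨hw0, hr1, hr2, hr3⟩ hw1
      have huw := hu.trans (hE.table 0 3)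
      have hrow := hE.evalPolyRow hw0 hgw (by omega)
      have hidx := WordExpr.eval_sub (hE.evalConst (a := 0) (b := 3) (by norm_num) (by norm_num)
        s'') (hE.evalCounter (c := 1) (by norm_num) hw1 huw) (hE.table 0 3)
      obtain ⟨v, hv⟩ : ∃ v, S - u = v + 1 := ⟨S - u - 1, by omega⟩
      rw [← hS, hv] at hidx
      have hidx' := WordExpr.eval_sub hidx (hE.evalLit (n := 1) (by norm_num) s'')
        (by have := hE.table 0 3; omega)
      refine (halts_setScalar (i := b₀ + 3) (j := v + 1)
        (v := polyCells (nodePoly E (g + 1) b₀) (v + 1))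
        hrow hidx (by simp [ScalarExpr.Defined]) ?_ ?_).mono ?_ fun _ h => h
      · rw [nodePoly_succ, if_pos hb₀, polyCells_mul]
        have e1 := hr3 (v + 1) (by omega)
        have e2 := hr3 v (by omega)
        rw [if_neg (by omega)] at e1 e2
        rw [← e1, ← e2]
        exact ScalarExpr.eval_sub (ScalarExpr.eval_cell hrow hidx) (ScalarExpr.eval_mul
          (ScalarExpr.eval_root (hE.evalIndex (hE.evalCounter (by norm_num) hw0 hgw)))
          (ScalarExpr.eval_cell hrow hidx'))
      · refine ⟨hw1, by simpa [Memory.setWord_word] using hw0, fun r hr => ?_,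
          fun b hb hbb t ht => ?_, fun t ht => ?_⟩
        · ext x
          simp [Memory.setScalar_scalar, (show r ≠ b₀ + 3 by omega), hr1 r hr]
        · simp [Memory.setScalar_scalar, hbb, hr2 b hb hbb t ht]
        · simp only [Memory.setWord_scalar, Memory.setScalar_scalar, true_and, hr3 t ht]
          rcases lt_trichotomy t (v + 1) with h | h | h
          · rw [if_neg (by omega), if_neg (by omega), if_neg (by omega)]
          · rw [if_pos h, if_pos (by omega), h]
          · rw [if_neg (by omega), if_pos (by omega), if_pos (by omega)]
      · simp [ScalarExpr.cost, WordExpr.cost, WordExpr.counter, polyRow]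
    · simp [WordExpr.cost]; omega
    · rintro s'' ⟨hw0, hr1, hr2, hr3⟩
      refine ⟨hw0, hr1, fun b hb t ht => ?_⟩
      rw [Memory.setWord_scalar]
      by_cases hbb : b = b₀
      · rw [hbb, hr3 t ht]
        -- Cell `0` is never rewritten, and it is zero for the old and the new polynomial alike.
        rcases t with _ | t
        · simp [polyCells]
        · rw [if_pos (by omega)]
      · rw [hr2 b hb hbb t ht, nodePoly_succ, if_neg (fun h => hbb h.symm)]
  · have : WordExpr.size.cost = 1 := rfl
    rw [this]
    nlinarith

/-- The coefficients of `p / (1 - z X)`, shifted by one. -/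
noncomputable def quotientCoeff (p : ℕ → ℂ) (z : ℂ) : ℕ → ℂ
  | 0 => 0
  | t + 1 => p t + z * quotientCoeff p z t

/-- The sum of `d (t + 1) * y t` over `t < n`, computed from left to right. -/
noncomputable def runningSum (d y : ℕ → ℂ) : ℕ → ℂ
  | 0 => 0
  | t + 1 => runningSum d y t + d (t + 1) * y t

/-- Horner's scheme for the coefficients `d 1, …, d n`. -/
noncomputable def hornerValue (d : ℕ → ℂ) (z : ℂ) : ℕ → ℂ
  | 0 => 0
  | t + 1 => hornerValue d z t * z + d (t + 1)

/-- A single pass produces the quotient coefficients, their pairing with the samples and their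
Horner value, so three temporaries suffice and each index costs `O(S)`. The hypothesis `hne` makes
the program's only division legal. -/
lemma halts_extraction (hE : E.Fits) {V : ℕ → ℂ} {L : ℕ} (hw : E.table 0 1 + 3 < 2 ^ E.w)
    (hL : L < 2 ^ E.w) (h03 : E.table 0 3 + 1 < 2 ^ E.w)
    (h5 : ∀ i < E.size, E.table 5 (E.index i) < E.table 0 1)
    (h6 : ∀ i < E.size, E.table 6 (E.index i) + E.table 0 3 ≤ L)
    (s : Memory) (hs : ∀ q < L, s.scalar 1 q = V q)
    (hs' : ∀ b < E.table 0 1, ∀ t ≤ E.table 0 3,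
        s.scalar (b + 3) t = polyCells (nodePoly E E.size b) t)
    (hne : ∀ i < E.size, hornerValue (quotientCoeff
      (nodePoly E E.size (E.table 5 (E.index i))).coeff (unityRoot M (E.index i)))
      (unityRoot M (E.index i)) (E.table 0 3) ≠ 0) :
    Halts E extraction s (E.size * (E.table 0 3 * 90 + 70) + 12) fun s' =>
      ∀ i < E.size, s'.scalar 0 i =
        runningSum (quotientCoeff (nodePoly E E.size (E.table 5 (E.index i))).coeff
          (unityRoot M (E.index i))) (fun t => V (E.table 6 (E.index i) + t)) (E.table 0 3) /
        hornerValue (quotientCoeff (nodePoly E E.size (E.table 5 (E.index i))).coeff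
          (unityRoot M (E.index i))) (unityRoot M (E.index i)) (E.table 0 3) * E.table 0 4 := by
  refine (halts_forLoop (n := E.size) (T := E.table 0 3 * 90 + 50) (fun g s' =>
    (∀ r ≠ 0, r ≠ 2 → s'.scalar r = s.scalar r) ∧ ∀ i < g, s'.scalar 0 i =
        runningSum (quotientCoeff (nodePoly E E.size (E.table 5 (E.index i))).coeff
          (unityRoot M (E.index i))) (fun t => V (E.table 6 (E.index i) + t)) (E.table 0 3) /
        hornerValue (quotientCoeff (nodePoly E E.size (E.table 5 (E.index i))).coeff
          (unityRoot M (E.index i))) (unityRoot M (E.index i)) (E.table 0 3) * E.table 0 4)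
    (by linarith [hE.lit]) (by linarith [hE.lit]) hE.size
    hE.evalSize (by simp) ?_).mono ?_ fun s' h => h.2
  swap
  · have : WordExpr.size.cost = 1 := rfl
    rw [this]
    nlinarith
  rintro g hg s₁ ⟨hr1, hr2⟩ hs₁
  have hgw := hg.trans hE.size
  set S := E.table 0 3 with hS
  set z := unityRoot M (E.index g) with hz
  set b₀ := E.table 5 (E.index g) with hb₀
  set d := quotientCoeff (nodePoly E E.size b₀).coeff z with hd
  set y : ℕ → ℂ := fun t => V (E.table 6 (E.index g) + t) with hy
  have hb₀lt : b₀ < E.table 0 1 := h5 g hg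
  have clear : ∀ (c : ℕ) (s₂ : Memory), c < 3 → Halts E
      (.setScalar (.lit 2) (.lit c) (.ofWord (.lit 0))) s₂ 5
      fun s₃ => s₃ = s₂.setScalar 2 c 0 := fun c s₂ hc =>
    halts_setScalar (hE.evalLit (by norm_num) _) (hE.evalLit (by omega) _) (by trivial)
      (by simpa using ScalarExpr.eval_ofLit hE (n := 0) (by norm_num) s₂) rfl
  have final : ∀ s₂ : Memory, s₂.word 0 0 = g → s₂.scalar 2 1 = runningSum d y S →
      s₂.scalar 2 2 = hornerValue d z S → Halts E
      (.setScalar (.lit 0) (.counter 0) (.mul (.div (.temp 1) (.temp 2))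
        (.ofWord (.table (.lit 0) (.lit 4))))) s₂ 17
      fun s₃ => s₃ = s₂.setScalar 0 g (runningSum d y S / hornerValue d z S * E.table 0 4) := by
    intro s₂ hw0 h1 h2
    refine halts_setScalar (hE.evalLit (by norm_num) _) (hE.evalCounter (by norm_num) hw0 hgw)
      (show ScalarExpr.Defined E s₂ (.mul (.div (.temp 1) (.temp 2))
        (.ofWord (.table (.lit 0) (.lit 4)))) from ⟨⟨trivial, trivial, ?_⟩, trivial⟩) ?_ rfl
    · rw [ScalarExpr.eval_temp hE (by norm_num), h2]
      exact hne g hg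
    · refine ScalarExpr.eval_mul (ScalarExpr.eval_div ?_ ?_) ?_
      · rw [ScalarExpr.eval_temp hE (by norm_num), h1]
      · rw [ScalarExpr.eval_temp hE (by norm_num), h2]
      · simp [ScalarExpr.eval, hE.evalConst (a := 0) (b := 4) (by norm_num) (by norm_num)]
  refine ((clear 0 s₁ (by norm_num)).seq (U := S * 90 + 45) ?_).mono (by omega) fun _ h => h
  rintro _ rfl
  refine ((clear 1 _ (by norm_num)).seq (U := S * 90 + 40) ?_).mono (by omega) fun _ h => h
  rintro _ rfl
  refine ((clear 2 _ (by norm_num)).seq (U := S * 90 + 35) ?_).mono (by omega) fun _ h => h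
  rintro _ rfl
  -- The temporaries `(2, 0)`, `(2, 1)`, `(2, 2)` hold the current quotient coefficient, the running
  -- sum and the Horner value. The first is updated first, since the other two use its new value.
  refine ((halts_forLoop (n := S) (T := 66) (fun u s₂ => s₂.word 0 0 = g ∧
      (∀ r ≠ 2, s₂.scalar r = s₁.scalar r) ∧ s₂.scalar 2 0 = d u ∧
      s₂.scalar 2 1 = runningSum d y u ∧ s₂.scalar 2 2 = hornerValue d z u)
      (by linarith [hE.lit]) (by linarith [hE.lit]) (hE.table 0 3)
      (hE.evalConst (by norm_num) (by norm_num)) ?_ ?_).seq (U := 17) ?_).mono ?_ fun _ h => h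
  · refine ⟨by simpa [Memory.setWord_word] using hs₁, fun r hr => ?_, ?_, ?_, ?_⟩
    · ext x
      simp [Memory.setScalar_scalar, hr]
    all_goals simp [Memory.setScalar_scalar, hd, quotientCoeff, runningSum, hornerValue]
  · rintro u hu s₂ ⟨hw0, hf, h0, h1, h2⟩ hw1
    have huw := hu.trans (hE.table 0 3)
    have hroot : ∀ s₃ : Memory, s₃.word 0 0 = g →
        (ScalarExpr.root (.index (.counter 0))).eval E s₃ = z := fun s₃ h =>
      ScalarExpr.eval_root (hE.evalIndex (hE.evalCounter (by norm_num) h hgw))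
    have hl : ∀ n < 32, ∀ s₃, (WordExpr.lit n).eval E s₃ = n := fun n hn s₃ => hE.evalLit hn s₃
    have first := halts_setScalar (E := E) (a := .lit 2) (b := .lit 0) (s := s₂)
      (x := .add (.cell polyRow (.add (.counter 1) (.lit 1)))
          (.mul (.root (.index (.counter 0))) (.temp 0))) (i := 2) (j := 0) (v := d (u + 1))
      (Q := fun s₃ => s₃ = s₂.setScalar 2 0 (d (u + 1)))
      (hl 2 (by norm_num) _) (hl 0 (by norm_num) _)
      (by simp [ScalarExpr.Defined, ScalarExpr.temp]) (by
        have e := hs' b₀ hb₀lt (u + 1) (by omega)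
        rw [hd, quotientCoeff, ← hd]
        refine ScalarExpr.eval_add ?_ (ScalarExpr.eval_mul (hroot _ hw0)
          ((ScalarExpr.eval_temp hE (by norm_num) _).trans h0))
        rw [ScalarExpr.eval_cell (hE.evalPolyRow hw0 hgw (by omega)) (WordExpr.eval_add
          (hE.evalCounter (by norm_num) hw1 huw) (hl 1 (by norm_num) _) (by omega)), ← hb₀,
          hf _ (by omega), hr1 _ (by omega) (by omega), e, polyCells]) rfl
    refine (first.seq (U := 39) ?_).mono ?_ fun _ h => h
    · rintro _ rfl
      set s₃ := s₂.setScalar 2 0 (d (u + 1)) with hs₃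
      have second := halts_setScalar (E := E) (a := .lit 2) (b := .lit 1) (s := s₃)
        (x := .add (.temp 1) (.mul (.temp 0)
          (.cell (.lit 1) (.add (.table (.lit 6) (.index (.counter 0))) (.counter 1)))))
        (i := 2) (j := 1) (v := runningSum d y (u + 1))
        (Q := fun s₄ => s₄ = s₃.setScalar 2 1 (runningSum d y (u + 1)))
        (hl 2 (by norm_num) _) (hl 1 (by norm_num) _)
        (by simp [ScalarExpr.Defined, ScalarExpr.temp]) (by
          have h6g := h6 g hg
          refine ScalarExpr.eval_add ((ScalarExpr.eval_temp hE (by norm_num) _).trans ?_)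
            (ScalarExpr.eval_mul ((ScalarExpr.eval_temp hE (by norm_num) _).trans ?_) ?_)
          · simpa [hs₃, Memory.setScalar_scalar] using h1
          · simp [hs₃, Memory.setScalar_scalar]
          · rw [ScalarExpr.eval_cell (s := s₃) (hl 1 (by norm_num) _) (WordExpr.eval_add
              (hE.evalTable (hl 6 (by norm_num) _)
                (hE.evalIndex (hE.evalCounter (by norm_num) hw0 hgw)))
              (hE.evalCounter (by norm_num) hw1 huw) (by omega))]
            rw [hs₃, Memory.setScalar_scalar, if_neg (by omega), hf 1 (by norm_num),
              hr1 1 (by norm_num) (by norm_num), hs _ (by omega)]) rfl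
      refine (second.seq (U := 16) ?_).mono ?_ fun _ h => h
      · rintro _ rfl
        refine (halts_setScalar (E := E) (a := .lit 2) (b := .lit 2)
          (s := s₃.setScalar 2 1 (runningSum d y (u + 1)))
          (x := .add (.mul (.temp 2) (.root (.index (.counter 0)))) (.temp 0))
          (i := 2) (j := 2) (v := hornerValue d z (u + 1))
          (Q := fun s₅ => s₅.word 0 1 = u ∧ (s₅.setWord 0 1 (u + 1)).word 0 0 = g ∧
            (∀ r ≠ 2, s₅.scalar r = s₁.scalar r) ∧ s₅.scalar 2 0 = d (u + 1) ∧
            s₅.scalar 2 1 = runningSum d y (u + 1) ∧ s₅.scalar 2 2 = hornerValue d z (u + 1))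
          (hl 2 (by norm_num) _) (hl 2 (by norm_num) _)
          (by simp [ScalarExpr.Defined, ScalarExpr.temp])
          (ScalarExpr.eval_add (ScalarExpr.eval_mul
            ((ScalarExpr.eval_temp hE (by norm_num) _).trans ?_)
            (hroot (s₃.setScalar 2 1 (runningSum d y (u + 1))) hw0))
            ((ScalarExpr.eval_temp hE (by norm_num) _).trans ?_))
          ⟨hw1, by simpa [Memory.setWord_word, hs₃] using hw0, fun r hr => ?_, ?_, ?_, ?_⟩).mono ?_
          fun _ h => h
        · simpa [hs₃, Memory.setScalar_scalar] using h2
        · simp [hs₃, Memory.setScalar_scalar]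
        · ext x
          simp [hs₃, Memory.setScalar_scalar, hr, hf r hr]
        · simp [hs₃, Memory.setScalar_scalar]
        · simp [hs₃, Memory.setScalar_scalar]
        · simp [hs₃, Memory.setScalar_scalar]
        · simp [ScalarExpr.cost, WordExpr.cost, WordExpr.counter, ScalarExpr.temp]
      · simp [ScalarExpr.cost, WordExpr.cost, WordExpr.counter, ScalarExpr.temp]
    · simp [ScalarExpr.cost, WordExpr.cost, WordExpr.counter, ScalarExpr.temp, polyRow]
  · rintro s₂ ⟨hw0, hf, -, h1, h2⟩
    refine (final s₂ hw0 h1 h2).mono le_rfl ?_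
    rintro _ rfl
    refine ⟨hw0, fun r hr0 hr2' => ?_, fun i hi => ?_⟩
    · ext x
      simp [Memory.setScalar_scalar, hr0, hf r hr2', hr1 r hr0 hr2']
    · simp only [Memory.setWord_scalar, Memory.setScalar_scalar, true_and]
      split_ifs with h
      · rw [h]
      · rw [hf 0 (by norm_num), hr2 i (by omega)]
  · simp only [WordExpr.cost]
    omega

lemma halts_dftProgram (hE : E.Fits) {V : ℕ → ℂ} (h01 : E.table 0 1 + 3 < 2 ^ E.w)
    (h02 : E.table 0 0 + E.table 0 2 < 2 ^ E.w) (h03 : E.table 0 3 + 1 < 2 ^ E.w)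
    (hsample : ∀ q < E.table 0 0, V q = E.f (E.table 1 q))
    (h2 : ∀ g < E.table 0 2, E.table 2 g < E.table 0 0 + g)
    (h4 : ∀ g < E.table 0 2, E.table 4 g < E.table 0 0 + g)
    (hV : ∀ g < E.table 0 2, V (E.table 0 0 + g) =
      V (E.table 2 g) + unityRoot M (E.table 3 g) * V (E.table 4 g))
    (h5 : ∀ i < E.size, E.table 5 (E.index i) < E.table 0 1)
    (h6 : ∀ i < E.size, E.table 6 (E.index i) + E.table 0 3 ≤ E.table 0 0 + E.table 0 2)
    (hne : ∀ i < E.size, hornerValue (quotientCoeff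
      (nodePoly E E.size (E.table 5 (E.index i))).coeff (unityRoot M (E.index i)))
      (unityRoot M (E.index i)) (E.table 0 3) ≠ 0) :
    Halts E dftProgram Memory.init
      (30 * E.table 0 0 + 50 * E.table 0 2 + 30 * E.table 0 1 +
        E.size * (170 * E.table 0 3 + 110) + 60) fun s' =>
      ∀ i < E.size, s'.scalar 0 i =
        runningSum (quotientCoeff (nodePoly E E.size (E.table 5 (E.index i))).coeff
          (unityRoot M (E.index i))) (fun t => V (E.table 6 (E.index i) + t)) (E.table 0 3) /
        hornerValue (quotientCoeff (nodePoly E E.size (E.table 5 (E.index i))).coeff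
          (unityRoot M (E.index i))) (unityRoot M (E.index i)) (E.table 0 3) * E.table 0 4 := by
  -- The last two phases cost `80 S + 40` and `90 S + 70` per index, and each of the five phases has
  -- overhead `12`.
  refine ((halts_sampling hE hsample Memory.init).seq fun s₁ ⟨f₁, g₁⟩ =>
    (halts_butterflies hE h02 h2 h4 hV s₁ g₁).seq fun s₂ ⟨f₂, g₂⟩ =>
    (halts_initPolynomials hE h01 s₂ ?_).seq fun s₃ ⟨f₃, g₃⟩ =>
    (halts_multiplyPolynomials hE h01 h5 s₃ g₃).seq fun s₄ ⟨f₄, g₄⟩ =>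
    halts_extraction hE h01 h02 h03 h5 h6 s₄ ?_ g₄ hne).mono (by nlinarith) fun _ h => h
  · intro r
    rw [f₂ _ (by omega), f₁ _ (by omega)]
    rfl
  · intro q hq
    rw [f₄ 1 (by norm_num), f₃ 1 (by norm_num), g₂ q hq]

end Machine

/-! ## Solving the Vandermonde systems -/

section Vandermonde

open Polynomial

/-- The recursion is synthetic division by `1 - z X`: the term `z * quotientCoeff` restores what
multiplication by the factor had subtracted. -/
lemma quotientCoeff_mul (p : ℂ[X]) (z : ℂ) (t : ℕ) :
    quotientCoeff (p * (1 - C z * X)).coeff z (t + 1) = p.coeff t := by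
  induction t with
  | zero => simp [quotientCoeff, mul_coeff_zero]
  | succ t ih =>
    rw [quotientCoeff, ih, mul_sub, mul_one, ← mul_assoc, mul_comm p (C z), mul_assoc]
    simp

lemma runningSum_eq_sum (d y : ℕ → ℂ) (n : ℕ) :
    runningSum d y n = ∑ t ∈ Finset.range n, d (t + 1) * y t := by
  induction n with
  | zero => simp [runningSum]
  | succ n ih => rw [runningSum, ih, Finset.sum_range_succ]

lemma hornerValue_eq_sum (d : ℕ → ℂ) (z : ℂ) (n : ℕ) :
    hornerValue d z n = ∑ t ∈ Finset.range n, d (t + 1) * z ^ (n - 1 - t) := by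
  induction n with
  | zero => simp [hornerValue]
  | succ n ih =>
    rw [hornerValue, ih, Finset.sum_range_succ, Finset.sum_mul]
    congr 1
    · refine Finset.sum_congr rfl fun t ht => ?_
      have := Finset.mem_range.1 ht
      rw [mul_assoc, ← pow_succ]
      congr 2
      omega
    · simp

/-- Horner's scheme, fed with coefficients in ascending order, evaluates the reversed polynomial.
This is why the zeros of interest are the inverses `z⁻¹`. -/
lemma sum_coeff_mul_pow (p : ℂ[X]) {z : ℂ} (hz : z ≠ 0) {n : ℕ} (hn : p.natDegree < n) :
    ∑ t ∈ Finset.range n, p.coeff t * z ^ (n - 1 - t) = z ^ (n - 1) * p.eval z⁻¹ := by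
  rw [eval_eq_sum_range' hn, Finset.mul_sum]
  refine Finset.sum_congr rfl fun t ht => ?_
  have := Finset.mem_range.1 ht
  rw [inv_pow, pow_sub₀ _ hz (by omega)]
  ring

lemma eval_prod_one_sub {ι : Type*} (F : Finset ι) (z : ι → ℂ) (x : ℂ) :
    (∏ i ∈ F, (1 - C (z i) * X)).eval x = ∏ i ∈ F, (1 - z i * x) := by
  simp [eval_prod]

lemma natDegree_prod_one_sub {ι : Type*} (F : Finset ι) (z : ι → ℂ) :
    (∏ i ∈ F, (1 - C (z i) * X)).natDegree ≤ F.card := by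
  refine (natDegree_prod_le _ _).trans ?_
  rw [Finset.card_eq_sum_ones]
  refine Finset.sum_le_sum fun i _ => ?_
  compute_degree

/-- The exponential sum `∑ c i * z i ^ (n - 1 - t)`, `t < n`, determines its coefficients. -/
lemma vandermonde_solution {ι : Type*} [DecidableEq ι] {F : Finset ι} {z c : ι → ℂ} {y : ℕ → ℂ}
    {n : ℕ} (hz : ∀ i ∈ F, z i ≠ 0) (hinj : Set.InjOn z F) (hn : F.card ≤ n)
    (hy : ∀ t < n, y t = ∑ i ∈ F, c i * z i ^ (n - 1 - t)) {i₀ : ι} (hi₀ : i₀ ∈ F) :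
    hornerValue (quotientCoeff (∏ i ∈ F, (1 - C (z i) * X)).coeff (z i₀)) (z i₀) n ≠ 0 ∧
    runningSum (quotientCoeff (∏ i ∈ F, (1 - C (z i) * X)).coeff (z i₀)) y n /
      hornerValue (quotientCoeff (∏ i ∈ F, (1 - C (z i) * X)).coeff (z i₀)) (z i₀) n =
        c i₀ := by
  -- The dual Lagrange polynomial: it vanishes at `(z i)⁻¹` for every `i ≠ i₀` in `F`, but not at
  -- `(z i₀)⁻¹`.
  set p : ℂ[X] := ∏ i ∈ F.erase i₀, (1 - C (z i) * X) with hp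
  have hprod : ∏ i ∈ F, (1 - C (z i) * X) = p * (1 - C (z i₀) * X) :=
    (Finset.prod_erase_mul _ _ hi₀).symm
  have hdeg : p.natDegree < n := by
    refine (natDegree_prod_one_sub _ _).trans_lt ?_
    rw [Finset.card_erase_of_mem hi₀]
    have := Finset.card_pos.2 ⟨i₀, hi₀⟩
    omega
  have hzero : ∀ i ∈ F, i ≠ i₀ → p.eval (z i)⁻¹ = 0 := by
    intro i hi hne
    rw [hp, eval_prod_one_sub]
    refine Finset.prod_eq_zero (Finset.mem_erase.2 ⟨hne, hi⟩) ?_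
    rw [mul_inv_cancel₀ (hz i hi), sub_self]
  have hne : z i₀ ^ (n - 1) * p.eval (z i₀)⁻¹ ≠ 0 := by
    refine mul_ne_zero (pow_ne_zero _ (hz _ hi₀)) ?_
    rw [hp, eval_prod_one_sub]
    refine Finset.prod_ne_zero_iff.2 fun i hi h => ?_
    obtain ⟨hne, hi⟩ := Finset.mem_erase.1 hi
    have h' : z i * (z i₀)⁻¹ = 1 := (sub_eq_zero.1 h).symm
    exact hne (hinj hi hi₀ (by rwa [mul_inv_eq_one₀ (hz _ hi₀)] at h'))
  have hden : hornerValue (quotientCoeff (∏ i ∈ F, (1 - C (z i) * X)).coeff (z i₀)) (z i₀) n =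
      z i₀ ^ (n - 1) * p.eval (z i₀)⁻¹ := by
    rw [hornerValue_eq_sum, hprod, ← sum_coeff_mul_pow p (hz _ hi₀) hdeg]
    simp_rw [quotientCoeff_mul]
  -- Pairing the samples with the coefficients of `p` gives `∑ c i * z i ^ (n - 1) * p (z i)⁻¹`
  -- after exchanging the sums, and only the term of `i₀` survives.
  have hnum : runningSum (quotientCoeff (∏ i ∈ F, (1 - C (z i) * X)).coeff (z i₀)) y n =
      c i₀ * (z i₀ ^ (n - 1) * p.eval (z i₀)⁻¹) := by
    rw [runningSum_eq_sum, hprod]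
    simp_rw [quotientCoeff_mul]
    rw [Finset.sum_congr rfl fun t ht => by rw [hy t (Finset.mem_range.1 ht), Finset.mul_sum],
      Finset.sum_comm, Finset.sum_eq_single_of_mem i₀ hi₀,
      ← sum_coeff_mul_pow p (hz _ hi₀) hdeg, Finset.mul_sum]
    · exact Finset.sum_congr rfl fun t _ => by ring
    · intro i hi hne
      calc _ = c i * ∑ t ∈ Finset.range n, p.coeff t * z i ^ (n - 1 - t) := by
            rw [Finset.mul_sum]
            exact Finset.sum_congr rfl fun t _ => by ring
        _ = 0 := by rw [sum_coeff_mul_pow p (hz _ hi) hdeg, hzero i hi hne]; ring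
  rw [hnum, hden]
  exact ⟨hne, mul_div_cancel_right₀ _ hne⟩

end Vandermonde

/-! ## The structure of homogeneous sets -/

/-- `c` and `c'` have the same binary digits in the positions below `i`. -/
def AgreeBelow (i c c' : ℕ) : Prop := ∀ a < i, c.testBit a = c'.testBit a

lemma agreeBelow_iff_mod {i c c' : ℕ} : AgreeBelow i c c' ↔ c % 2 ^ i = c' % 2 ^ i := by
  constructor
  · intro h
    refine Nat.eq_of_testBit_eq fun a => ?_
    simp only [Nat.testBit_mod_two_pow]
    by_cases ha : a < i
    · simp [ha, h a ha]
    · simp [ha]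
  · intro h a ha
    have := congrArg (fun x => x.testBit a) h
    simpa [Nat.testBit_mod_two_pow, ha] using this

lemma AgreeBelow.mono {i i' c c' : ℕ} (h : AgreeBelow i c c') (hi : i' ≤ i) :
    AgreeBelow i' c c' := fun a ha => h a (ha.trans_le hi)

/-- Elements with the same digits below `l` that differ at `l` make `l` a pivot. -/
lemma mem_pivots_of_agreeBelow {M : ℕ} {K : Finset (ZMod (2 ^ M))} {j j' : ZMod (2 ^ M)}
    (hj : j ∈ K) (hj' : j' ∈ K) {l : ℕ} (h : AgreeBelow l j.val j'.val)
    (hne : j.val.testBit l ≠ j'.val.testBit l) : l ∈ pivots K := by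
  wlog hb : j.val.testBit l = false generalizing j j'
  · refine this hj' hj (fun a ha => (h a ha).symm) hne.symm ?_
    cases hc : j'.val.testBit l <;> simp_all
  have hb' : j'.val.testBit l = true := by
    cases hc : j'.val.testBit l <;> simp_all
  have hlt : l < M := by
    by_contra hl
    rw [Nat.testBit_lt_two_pow ((ZMod.val_lt j').trans_le
      (Nat.pow_le_pow_right (by norm_num) (not_lt.1 hl)))] at hb'
    cases hb'
  have hm := agreeBelow_iff_mod.1 h
  rw [Nat.testBit_eq_decide_div_mod_eq, decide_eq_false_iff_not] at hb
  rw [Nat.testBit_eq_decide_div_mod_eq, decide_eq_true_iff] at hb'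
  refine Finset.mem_filter.2 ⟨Finset.mem_range.2 hlt, j.val % 2 ^ l,
    Nat.mod_lt _ (by positivity), ⟨j, Finset.mem_filter.2 ⟨hj, ?_⟩⟩,
    ⟨j', Finset.mem_filter.2 ⟨hj', ?_⟩⟩⟩
  · rw [Nat.mod_pow_succ, show j.val / 2 ^ l % 2 = 0 by omega, mul_zero, add_zero]
  · rw [Nat.mod_pow_succ, hb', hm, mul_one]

/-- An enumeration of a homogeneous set with `2 ^ P` elements, compatible with its congruence
tree, whose pivots are `l 0 < l 1 < … < l (P - 1)`. -/
structure TreeEnumeration {M : ℕ} (K : Finset (ZMod (2 ^ M))) (P : ℕ) where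
  elem : ℕ → ZMod (2 ^ M)
  code : ZMod (2 ^ M) → ℕ
  level : ℕ → ℕ
  code_lt : ∀ j ∈ K, code j < 2 ^ P
  elem_code : ∀ j ∈ K, elem (code j) = j
  elem_mem : ∀ c < 2 ^ P, elem c ∈ K
  code_elem : ∀ c < 2 ^ P, code (elem c) = c
  level_lt : ∀ i < P, level i < M
  agree : ∀ i < P, ∀ c < 2 ^ P, ∀ c' < 2 ^ P, AgreeBelow i c c' →
    AgreeBelow (level i) (elem c).val (elem c').val
  testBit : ∀ i < P, ∀ c < 2 ^ P, (elem c).val.testBit (level i) = c.testBit i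

lemma exists_treeEnumeration {M : ℕ} {K : Finset (ZMod (2 ^ M))} (hK : IsHomogeneous K) :
    Nonempty (TreeEnumeration K (pivots K).card) := by
  set P := (pivots K).card with hP
  set l : ℕ → ℕ := fun i => Nat.nth (· ∈ pivots K) i with hl
  have hfin : (Set.ofPred (· ∈ pivots K)).Finite := (pivots K).finite_toSet
  have hcard : hfin.toFinset.card = P := by
    congr 1
    ext x
    simp
  have hmem : ∀ i < P, l i ∈ pivots K := fun i hi =>
    Nat.nth_mem_of_lt_card hfin (by rwa [hcard])
  have hmono : ∀ i i', i < i' → i' < P → l i < l i' := fun i i' h hi' =>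
    Nat.nth_lt_nth' h fun hf => by rwa [← hcard] at hi'
  have hsurj : ∀ x ∈ pivots K, ∃ i < P, l i = x := fun x hx => by
    obtain ⟨i, hi, h⟩ := Nat.exists_lt_card_finite_nth_eq hfin hx
    exact ⟨i, by rwa [← hcard], h⟩
  -- Strong induction on the digit: at the first place where two elements differ there is a pivot,
  -- and at pivots below `x` they agree by assumption.
  have hagree : ∀ j ∈ K, ∀ j' ∈ K, ∀ x, (∀ i < P, l i < x → j.val.testBit (l i) =
      j'.val.testBit (l i)) → AgreeBelow x j.val j'.val := by
    intro j hj j' hj' x h a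
    induction a using Nat.strong_induction_on with
    | _ a ih =>
      intro ha
      by_contra hne
      obtain ⟨i, hi, rfl⟩ := hsurj a (mem_pivots_of_agreeBelow hj hj'
        (fun a' ha' => ih a' ha' (ha'.trans ha)) hne)
      exact hne (h i hi ha)
  set code : ZMod (2 ^ M) → ℕ := fun j =>
    Nat.ofBits (fun i : Fin P => j.val.testBit (l i)) with hcode
  have hbit : ∀ j, ∀ i < P, (code j).testBit i = j.val.testBit (l i) := fun j i hi =>
    Nat.testBit_ofBits_lt _ i hi
  have hlt : ∀ j, code j < 2 ^ P := fun j => Nat.ofBits_lt_two_pow _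
  have hinj : Set.InjOn code K := by
    intro j hj j' hj' h
    have := hagree j hj j' hj' M fun i hi _ => by rw [← hbit j i hi, ← hbit j' i hi, h]
    have := agreeBelow_iff_mod.1 this
    rw [Nat.mod_eq_of_lt (ZMod.val_lt j), Nat.mod_eq_of_lt (ZMod.val_lt j')] at this
    exact ZMod.val_injective _ this
  -- Homogeneity enters here: an injection of `2 ^ P` elements into the `2 ^ P` digit patterns is
  -- onto.
  have himage : K.image code = Finset.range (2 ^ P) := by
    refine Finset.eq_of_subset_of_card_le (fun x hx => ?_) ?_
    · obtain ⟨j, -, rfl⟩ := Finset.mem_image.1 hx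
      exact Finset.mem_range.2 (hlt j)
    · rw [Finset.card_image_of_injOn hinj, Finset.card_range]
      exact hK.ge
  have hex : ∀ c, ∃ j, c < 2 ^ P → j ∈ K ∧ code j = c := fun c => by
    by_cases hc : c < 2 ^ P
    · obtain ⟨j, hj, h⟩ := Finset.mem_image.1 (himage ▸ Finset.mem_range.2 hc)
      exact ⟨j, fun _ => ⟨hj, h⟩⟩
    · exact ⟨0, fun h => absurd h hc⟩
  choose elem helem using hex
  refine ⟨⟨elem, code, l, fun j _ => hlt j, fun j hj => ?_, fun c hc => (helem c hc).1,
    fun c hc => (helem c hc).2, fun i hi => ?_, fun i hi c hc c' hc' h => ?_,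
    fun i hi c hc => ?_⟩⟩
  · exact hinj (helem _ (hlt j)).1 hj (helem _ (hlt j)).2
  · exact Finset.mem_range.1 (Finset.mem_filter.1 (hmem i hi)).1
  · refine hagree _ (helem c hc).1 _ (helem c' hc').1 _ fun i' hi' hlt' => ?_
    have : i' < i := by
      by_contra hge
      rcases (not_lt.1 hge).lt_or_eq with h' | rfl
      · exact absurd (hmono i i' h' hi') (by omega)
      · exact lt_irrefl _ hlt'
    rw [← hbit _ i' hi', ← hbit _ i' hi', (helem c hc).2, (helem c' hc').2]
    exact h i' this
  · rw [← hbit _ i hi, (helem c hc).2]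

/-! ## The Fourier transform along the congruence tree -/

section Butterfly

variable {M : ℕ}

lemma unityRoot_eq (x : ℕ) : unityRoot M x = ZMod.stdAddChar (-(x : ZMod (2 ^ M))) := by
  have := ZMod.stdAddChar_coe (N := 2 ^ M) (-(x : ℤ))
  push_cast at this
  rw [this, unityRoot]
  congr 1
  ring

lemma stdAddChar_half {l : ℕ} (hl : l < M) :
    ZMod.stdAddChar ((2 : ZMod (2 ^ M)) ^ l * 2 ^ (M - 1 - l)) = -1 := by
  have h := ZMod.stdAddChar_coe (N := 2 ^ M) ((2 : ℤ) ^ (M - 1))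
  rw [← pow_add, show l + (M - 1 - l) = M - 1 by omega]
  push_cast at h
  rw [h, ← Complex.exp_pi_mul_I]
  congr 1
  obtain ⟨M', rfl⟩ : ∃ M', M = M' + 1 := ⟨M - 1, by omega⟩
  rw [Nat.add_sub_cancel, pow_succ]
  field_simp

/-- Multiplied by `2 ^ (M - 1 - l)`, the digits of `x` above `l` contribute full turns and digit `l`
contributes a half turn. -/
lemma stdAddChar_mul_level (x : ZMod (2 ^ M)) {l : ℕ} (hl : l < M) :
    ZMod.stdAddChar (x * 2 ^ (M - 1 - l)) =
      ZMod.stdAddChar (((x.val % 2 ^ l : ℕ) : ZMod (2 ^ M)) * 2 ^ (M - 1 - l)) *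
        (if x.val.testBit l then -1 else 1) := by
  have hx : x = ((x.val % 2 ^ l : ℕ) : ZMod (2 ^ M)) +
      (x.val / 2 ^ l : ℕ) * (2 : ZMod (2 ^ M)) ^ l := by
    have := congrArg (Nat.cast (R := ZMod (2 ^ M))) (Nat.mod_add_div x.val (2 ^ l))
    rw [ZMod.natCast_zmod_val] at this
    refine this.symm.trans ?_
    push_cast
    rw [mul_comm (2 ^ l : ZMod (2 ^ M))]
  conv_lhs => rw [hx]
  rw [add_mul, AddChar.map_add_eq_mul, mul_assoc,
    ← nsmul_eq_mul (x.val / 2 ^ l), AddChar.map_nsmul_eq_pow, stdAddChar_half hl, Nat.testBit_eq_decide_div_mod_eq]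
  congr 1
  rcases Nat.mod_two_eq_zero_or_one (x.val / 2 ^ l) with h | h
  · simp [h, (Nat.even_iff.2 h).neg_one_pow]
  · simp [h, (Nat.odd_iff.2 h).neg_one_pow]

variable {K : Finset (ZMod (2 ^ M))} {P : ℕ}

/-- The component of a signal with coefficients `a` at the frequencies in the `b`-th node below
the first `i` pivots. -/
noncomputable def TreeEnumeration.nodeSum (T : TreeEnumeration K P) (a : ZMod (2 ^ M) → ℂ)
    (i b : ℕ) (n : ZMod (2 ^ M)) : ℂ :=
  ∑ j ∈ K.filter fun j => T.code j % 2 ^ i = b % 2 ^ i, a j * ZMod.stdAddChar (j * n)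

lemma TreeEnumeration.nodeSum_congr (T : TreeEnumeration K P) (a : ZMod (2 ^ M) → ℂ)
    {i b b' : ℕ} (h : AgreeBelow i b b') (n : ZMod (2 ^ M)) :
    T.nodeSum a i b n = T.nodeSum a i b' n := by
  rw [nodeSum, nodeSum, agreeBelow_iff_mod.1 h]

/-- For `j` in the node, the shift followed by the twiddle factor multiplies the term of `j` by `1`
if `j` lies in the same child as `T.elem b`, and by `-1` otherwise. The sum of the two samples
doubles the former terms and cancels the latter. -/
lemma TreeEnumeration.nodeSum_succ (T : TreeEnumeration K P) (a : ZMod (2 ^ M) → ℂ)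
    {i b : ℕ} (hi : i < P) (hb : b < 2 ^ P) (n : ZMod (2 ^ M)) :
    2 * T.nodeSum a (i + 1) b n = T.nodeSum a i b n +
      ZMod.stdAddChar (-(T.elem b * 2 ^ (M - 1 - T.level i))) *
        T.nodeSum a i b (2 ^ (M - 1 - T.level i) + n) := by
  have hl := T.level_lt i hi
  set h : ZMod (2 ^ M) := 2 ^ (M - 1 - T.level i) with hh
  have hfilter : (K.filter fun j => T.code j % 2 ^ (i + 1) = b % 2 ^ (i + 1)) =
      (K.filter fun j => T.code j % 2 ^ i = b % 2 ^ i).filter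
        fun j => (T.code j).testBit i = b.testBit i := by
    ext j
    simp only [Finset.mem_filter, ← agreeBelow_iff_mod, and_assoc]
    refine and_congr_right fun _ => ⟨fun H => ⟨H.mono (by omega), H i (by omega)⟩, ?_⟩
    rintro ⟨H, H'⟩ a ha
    rcases Nat.lt_succ_iff_lt_or_eq.1 ha with ha | rfl
    · exact H a ha
    · exact H'
  simp only [nodeSum]
  rw [hfilter, Finset.sum_filter, Finset.mul_sum, Finset.mul_sum, ← Finset.sum_add_distrib]
  refine Finset.sum_congr rfl fun j hj => ?_
  obtain ⟨hjK, hjb⟩ := Finset.mem_filter.1 hj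
  have hag := T.agree i hi _ (T.code_lt j hjK) b hb (agreeBelow_iff_mod.2 hjb)
  rw [T.elem_code j hjK] at hag
  have hbit := T.testBit i hi _ (T.code_lt j hjK)
  rw [T.elem_code j hjK] at hbit
  have hbit' := T.testBit i hi b hb
  have e1 := stdAddChar_mul_level j hl
  have e2 := stdAddChar_mul_level (T.elem b) hl
  rw [agreeBelow_iff_mod.1 hag, hbit, ← hh] at e1
  rw [hbit', ← hh] at e2
  set r := ((((T.elem b).val % 2 ^ T.level i : ℕ) : ZMod (2 ^ M)) * h) with hr
  rw [mul_add, AddChar.map_add_eq_mul, e1, AddChar.map_neg_eq_inv, e2]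
  have hne : ZMod.stdAddChar r ≠ 0 := by
    rw [ZMod.stdAddChar_apply]; exact Circle.coe_ne_zero _
  cases (T.code j).testBit i <;> cases b.testBit i <;> simp <;> field_simp <;> ring

/-- The coordinates of the sample points that the `b`-th value refers to after `i` steps. -/
def TreeEnumeration.position (T : TreeEnumeration K P) (m i b : ℕ) : ZMod (2 ^ M) :=
  ∑ a ∈ Finset.Ico i m, if b.testBit a then 2 ^ (M - 1 - T.level a) else 0

/-- `b` with the binary digit `i` replaced by `1`. -/
def withDigit (i b : ℕ) : ℕ := b ||| 2 ^ i

/-- `b` with the binary digit `i` replaced by `0`. -/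
def withoutDigit (i b : ℕ) : ℕ := (b ||| 2 ^ i) ^^^ 2 ^ i

lemma testBit_withDigit (i b a : ℕ) :
    (withDigit i b).testBit a = (b.testBit a || decide (i = a)) := by
  simp [withDigit, Nat.testBit_two_pow]

lemma testBit_withoutDigit (i b a : ℕ) :
    (withoutDigit i b).testBit a = (b.testBit a && decide (i ≠ a)) := by
  rcases eq_or_ne i a with rfl | h <;> simp [withoutDigit, *]

lemma withDigit_lt {m i b : ℕ} (hb : b < 2 ^ m) (hi : i < m) : withDigit i b < 2 ^ m :=
  Nat.or_lt_two_pow hb (Nat.pow_lt_pow_right (by norm_num) hi)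

lemma withoutDigit_lt {m i b : ℕ} (hb : b < 2 ^ m) (hi : i < m) : withoutDigit i b < 2 ^ m :=
  Nat.xor_lt_two_pow (withDigit_lt hb hi) (Nat.pow_lt_pow_right (by norm_num) hi)

/-- The value with indices `b`, `t` after `i` steps. -/
noncomputable def TreeEnumeration.stageValue (T : TreeEnumeration K P) (a : ZMod (2 ^ M) → ℂ)
    (m S i b t : ℕ) : ℂ :=
  2 ^ i * T.nodeSum a i b (T.position m i b - (S - 1 - t : ℕ))

/-- The digits of `b` below `i` name a node; those from `i` on choose shifts of the sample point.
The step turns digit `i` from a shift into part of the name, so its operands are the entries with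
that digit cleared and set. The power `2 ^ i` absorbs the factor `2` of `nodeSum_succ`, which leaves
a butterfly without division. -/
lemma TreeEnumeration.stageValue_succ (T : TreeEnumeration K P) (a : ZMod (2 ^ M) → ℂ)
    {m S i b t : ℕ} (hm : m ≤ P) (hi : i < m) (hb : b < 2 ^ m) :
    T.stageValue a m S (i + 1) b t = T.stageValue a m S i (withoutDigit i b) t +
      unityRoot M (T.elem b * 2 ^ (M - 1 - T.level i)).val *
        T.stageValue a m S i (withDigit i b) t := by
  have hsum : ∀ b', (∀ x, i + 1 ≤ x → b'.testBit x = b.testBit x) →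
      T.position m i b' = (if b'.testBit i then 2 ^ (M - 1 - T.level i) else 0) +
        T.position m (i + 1) b := by
    intro b' hb'
    rw [position, ← Finset.sum_Ioo_add_eq_sum_Ico hi, add_comm, position]
    congr 1
    refine Finset.sum_congr (by ext; simp) fun x hx => ?_
    rw [hb' x (Finset.mem_Ioo.1 hx).1]
  have p0 := hsum (withoutDigit i b) fun x hx => by
    simp [testBit_withoutDigit, show i ≠ x by omega]
  have p1 := hsum (withDigit i b) fun x hx => by
    simp [testBit_withDigit, show i ≠ x by omega]
  rw [testBit_withoutDigit] at p0
  rw [testBit_withDigit] at p1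
  simp only [ne_eq, not_true_eq_false, decide_false, Bool.and_false, Bool.false_eq_true,
    if_false, zero_add, decide_true, Bool.or_true, if_true] at p0 p1
  have hag0 : AgreeBelow i (withoutDigit i b) b := fun x hx => by
    simp [testBit_withoutDigit, hx.ne']
  have hag1 : AgreeBelow i (withDigit i b) b := fun x hx => by
    simp [testBit_withDigit, hx.ne']
  rw [stageValue, stageValue, stageValue, p0, p1, T.nodeSum_congr a hag0, T.nodeSum_congr a hag1,
    unityRoot_eq, ZMod.natCast_zmod_val, pow_succ, mul_assoc,
    T.nodeSum_succ a (hi.trans_le hm) (hb.trans_le (Nat.pow_le_pow_right (by norm_num) hm)),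
    add_sub_assoc]
  ring

/-- The values of all stages in a single list. -/
noncomputable def TreeEnumeration.listedValue (T : TreeEnumeration K P) (a : ZMod (2 ^ M) → ℂ)
    (m S g : ℕ) : ℂ :=
  T.stageValue a m S (g / (2 ^ m * S)) (g % (2 ^ m * S) / S) (g % (2 ^ m * S) % S)

lemma block_lt {m S b t : ℕ} (hb : b < 2 ^ m) (ht : t < S) : b * S + t < 2 ^ m * S :=
  calc b * S + t < (b + 1) * S := by rw [add_mul, one_mul]; omega
    _ ≤ 2 ^ m * S := Nat.mul_le_mul_right _ hb

lemma TreeEnumeration.listedValue_block (T : TreeEnumeration K P) (a : ZMod (2 ^ M) → ℂ)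
    {m S b t : ℕ} (i : ℕ) (hb : b < 2 ^ m) (ht : t < S) :
    T.listedValue a m S (i * (2 ^ m * S) + (b * S + t)) = T.stageValue a m S i b t := by
  have h := block_lt hb ht
  have h1 : (i * (2 ^ m * S) + (b * S + t)) / (2 ^ m * S) = i := by
    rw [add_comm, Nat.add_mul_div_right _ _ (by omega), Nat.div_eq_of_lt h, zero_add]
  have h2 : (i * (2 ^ m * S) + (b * S + t)) % (2 ^ m * S) = b * S + t := by
    rw [add_comm, Nat.add_mul_mod_self_right, Nat.mod_eq_of_lt h]
  have h3 : (b * S + t) / S = b := by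
    rw [add_comm, Nat.add_mul_div_right _ _ (by omega), Nat.div_eq_of_lt ht, zero_add]
  have h4 : (b * S + t) % S = t := by
    rw [add_comm, Nat.add_mul_mod_self_right, Nat.mod_eq_of_lt ht]
  rw [listedValue, h1, h2, h3, h4]

/-- The coefficient sequence of a signal in the Fourier basis. -/
noncomputable def fourierCoefficient (f : ZMod (2 ^ M) → ℂ) (j : ZMod (2 ^ M)) : ℂ :=
  𝓕 f j / 2 ^ M

/-- Above all pivots there is one node, the whole of `K`, so Fourier inversion identifies its
component with the signal itself. -/
lemma TreeEnumeration.nodeSum_zero (T : TreeEnumeration K P) {J : Set (ZMod (2 ^ M))}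
    (hJ : J ⊆ K) {f : ZMod (2 ^ M) → ℂ} (hf : f ∈ Bandlimited J) (b : ℕ) (n : ZMod (2 ^ M)) :
    T.nodeSum (fourierCoefficient f) 0 b n = f n := by
  have h : f n = 𝓕⁻ (𝓕 f) n := by rw [LinearEquiv.symm_apply_apply]
  rw [h, ZMod.invDFT_apply, nodeSum]
  simp only [pow_zero, Nat.mod_one, Finset.filter_true, smul_eq_mul]
  rw [Finset.mul_sum]
  refine (Finset.sum_subset (Finset.subset_univ K) fun j _ hj => ?_).trans
    (Finset.sum_congr rfl fun j _ => ?_)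
  · rw [fourierCoefficient, hf j fun h => hj (hJ h)]
    simp
  · rw [fourierCoefficient]
    push_cast
    ring

/-- After `m` steps no shifts are left: the samples of a node lie at consecutive points, which gives
powers of `stdAddChar (-j)` and hence Vandermonde systems. -/
lemma TreeEnumeration.stageValue_last (T : TreeEnumeration K P) (a : ZMod (2 ^ M) → ℂ)
    (m S b t : ℕ) : T.stageValue a m S m b t =
      ∑ j ∈ K.filter fun j => T.code j % 2 ^ m = b % 2 ^ m,
        2 ^ m * a j * ZMod.stdAddChar (-j) ^ (S - 1 - t) := by
  rw [stageValue, nodeSum, Finset.mul_sum]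
  refine Finset.sum_congr rfl fun j _ => ?_
  rw [position, Finset.Ico_self, Finset.sum_empty, zero_sub, mul_neg, ← neg_mul, mul_comm (-j),
    ← nsmul_eq_mul, AddChar.map_nsmul_eq_pow, mul_assoc]

end Butterfly

/-! ## The precomputed table and the correctness of the program -/

section Correctness

variable {M : ℕ} {K : Finset (ZMod (2 ^ M))} {P : ℕ}

/-- The table prepared for the butterflies down to level `m` with `S` samples per node. -/
noncomputable def TreeEnumeration.tableEntry (T : TreeEnumeration K P) (m S : ℕ) : ℕ → ℕ → ℕ
  | 0, 0 => 2 ^ m * S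
  | 0, 1 => 2 ^ m
  | 0, 2 => m * (2 ^ m * S)
  | 0, 3 => S
  | 0, 4 => 2 ^ (M - m)
  | 1, q => (T.position m 0 (q / S) - (S - 1 - q % S : ℕ)).val
  | 2, g => g / (2 ^ m * S) * (2 ^ m * S) +
      (withoutDigit (g / (2 ^ m * S)) (g % (2 ^ m * S) / S) * S + g % (2 ^ m * S) % S)
  | 3, g => (T.elem (g % (2 ^ m * S) / S) * 2 ^ (M - 1 - T.level (g / (2 ^ m * S)))).val
  | 4, g => g / (2 ^ m * S) * (2 ^ m * S) +
      (withDigit (g / (2 ^ m * S)) (g % (2 ^ m * S) / S) * S + g % (2 ^ m * S) % S)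
  | 5, j => T.code j % 2 ^ m
  | 6, j => m * (2 ^ m * S) + T.code j % 2 ^ m * S
  | _, _ => 0

/-- The elements of `K` in the `b`-th node below the first `m` pivots. -/
def TreeEnumeration.node (T : TreeEnumeration K P) (m b : ℕ) : Finset (ZMod (2 ^ M)) :=
  K.filter fun j => T.code j % 2 ^ m = b

lemma unityRoot_injOn : Set.InjOn (unityRoot M) (Set.Iio (2 ^ M)) := by
  intro x hx y hy h
  rw [unityRoot_eq, unityRoot_eq] at h
  have h' := neg_injective (ZMod.injective_stdAddChar h)
  rwa [ZMod.natCast_eq_natCast_iff, Nat.ModEq, Nat.mod_eq_of_lt hx, Nat.mod_eq_of_lt hy] at h'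

lemma unityRoot_ne_zero (x : ℕ) : unityRoot M x ≠ 0 := Complex.exp_ne_zero _

/-- The entries of the table satisfy the hypotheses of `halts_dftProgram` with `T.listedValue` as
the list of values, and the output is read off from `vandermonde_solution`. Randomness plays no
role: all that is asked of `J` is the load bound `hload`. -/
theorem TreeEnumeration.computesWithin (T : TreeEnumeration K P) {A : StructuredDFT} {m S : ℕ}
    (hprogram : A.program = dftProgram) (hfactor : A.wordFactor = 5)
    (htable : A.table M = fun a b => T.tableEntry m S a b % 2 ^ (5 * (M + 1)))
    (hm : m ≤ P) (hP : P ≤ M) (hQ : 2 ^ m * S ≤ 5 * 2 ^ M) (hS : 0 < S)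
    {J : Set (ZMod (2 ^ M))} (hJ : J ⊆ K)
    (hload : ∀ b < 2 ^ m, (J ∩ T.node m b).ncard ≤ S) :
    A.ComputesWithin J ((30 * (2 ^ m * S) + 50 * (m * (2 ^ m * S)) + 30 * 2 ^ m +
      2 ^ m * S * (170 * S + 110) + 60 : ℕ) : ℝ) := by
  intro n e f hf
  set E := A.input e f with hE
  set Q := 2 ^ m * S with hQdef
  -- Words range below `32 * N ^ 5` with `N = 2 ^ M`, whereas the largest addresses needed are of
  -- size about `(m + 1) * Q ≤ 5 * N ^ 2`.
  have hW : 2 ^ E.w = 32 * 2 ^ M * 2 ^ M * 2 ^ M * 2 ^ M * 2 ^ M := by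
    have : E.w = 5 * (M + 1) := by simp [hE, StructuredDFT.input, hfactor]
    rw [this]
    ring
  have hentry : ∀ a b, E.table a b = T.tableEntry m S a b % 2 ^ E.w := by
    intro a b
    have : E.w = 5 * (M + 1) := by simp [hE, StructuredDFT.input, hfactor]
    rw [this]
    simp only [hE, StructuredDFT.input, htable]
  have hN : M < 2 ^ M := Nat.lt_two_pow_self
  have hN1 : 1 ≤ 2 ^ M := Nat.one_le_two_pow
  have hmM : m ≤ M := hm.trans hP
  have hmN : 2 ^ m ≤ 2 ^ M := Nat.pow_le_pow_right (by norm_num) hmM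
  have hSQ : S ≤ Q := Nat.le_mul_of_pos_left _ (by positivity)
  have hmQ : m * Q + Q ≤ 5 * 2 ^ M * 2 ^ M := by
    calc m * Q + Q = (m + 1) * Q := by ring
      _ ≤ 2 ^ M * (5 * 2 ^ M) := Nat.mul_le_mul (by omega) hQ
      _ = _ := by ring
  have hWN : 32 * 2 ^ M * 2 ^ M ≤ 2 ^ E.w := by
    rw [hW, mul_assoc (32 * 2 ^ M * 2 ^ M), mul_assoc (32 * 2 ^ M * 2 ^ M)]
    exact Nat.le_mul_of_pos_right _ (by positivity)
  have hNN : 2 ^ M ≤ 2 ^ M * 2 ^ M := Nat.le_mul_of_pos_left _ (by positivity)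
  have hsmall : ∀ x, x ≤ m * Q + Q → x + 3 < 2 ^ E.w := by
    intro x hx
    nlinarith
  have hsmall' : ∀ x, x ≤ 2 ^ M → x + 3 < 2 ^ E.w := by
    intro x hx
    nlinarith
  have hmod : ∀ x, x + 3 < 2 ^ E.w → x % 2 ^ E.w = x := fun x hx =>
    Nat.mod_eq_of_lt (by omega)
  have hindex : ∀ i (hi : i < n), E.index i = (e ⟨i, hi⟩ : ZMod (2 ^ M)).val := by
    intro i hi
    simp [hE, StructuredDFT.input, hi]
  have hindex_lt : ∀ i, E.index i < 2 ^ M := by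
    intro i
    by_cases hi : i < n
    · rw [hindex i hi]
      exact ZMod.val_lt _
    · simp [hE, StructuredDFT.input, hi]
  have hcast : ∀ i (hi : i < n), (E.index i : ZMod (2 ^ M)) = e ⟨i, hi⟩ := by
    intro i hi
    rw [hindex i hi, ZMod.natCast_zmod_val]
  have hmemJ : ∀ i < n, (E.index i : ZMod (2 ^ M)) ∈ J := by
    intro i hi
    rw [hcast i hi]
    exact (e ⟨i, hi⟩).2
  have hinj : ∀ i < n, ∀ i' < n, E.index i = E.index i' → i = i' := by
    intro i hi i' hi' h
    have h' := congrArg (Nat.cast (R := ZMod (2 ^ M))) h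
    rw [hcast i hi, hcast i' hi'] at h'
    simpa using e.injective (Subtype.ext h')
  have hsize : E.size = n := rfl
  have t00 : E.table 0 0 = Q := by rw [hentry]; exact hmod _ (hsmall _ (by simp [tableEntry, hQdef]))
  have t01 : E.table 0 1 = 2 ^ m := by rw [hentry]; exact hmod _ (hsmall' _ hmN)
  have t02 : E.table 0 2 = m * Q := by
    rw [hentry]; exact hmod _ (hsmall _ (by simp [tableEntry, hQdef]))
  have t03 : E.table 0 3 = S := by
    rw [hentry]; exact hmod _ (hsmall _ (by simp only [tableEntry]; omega))
  have t04 : E.table 0 4 = 2 ^ (M - m) := by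
    rw [hentry]
    exact hmod _ (hsmall' _ (Nat.pow_le_pow_right (by norm_num) (Nat.sub_le _ _)))
  have t1 : ∀ q, E.table 1 q = (T.position m 0 (q / S) - (S - 1 - q % S : ℕ)).val := by
    intro q
    rw [hentry]
    exact hmod _ (hsmall' _ (ZMod.val_lt _).le)
  have t3 : ∀ g, E.table 3 g = (T.elem (g % Q / S) * 2 ^ (M - 1 - T.level (g / Q))).val := by
    intro q
    rw [hentry]
    exact hmod _ (hsmall' _ (ZMod.val_lt _).le)
  -- Stage `g / Q` occupies the list up to `(g / Q) * Q + Q ≤ Q + g`, so the operands of butterfly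
  -- `g` precede its result, which goes to place `Q + g`.
  have decode : ∀ g < m * Q, g / Q < m ∧ g % Q / S < 2 ^ m ∧ g % Q % S < S ∧
      g / Q * Q + Q ≤ Q + g := by
    intro g hg
    refine ⟨Nat.div_lt_of_lt_mul (by rwa [mul_comm]), Nat.div_lt_of_lt_mul ?_, Nat.mod_lt _ hS, ?_⟩
    · rw [mul_comm S]
      exact Nat.mod_lt _ (by omega)
    · have := Nat.div_mul_le_self g Q
      omega
  have t2 : ∀ g < m * Q, E.table 2 g =
      g / Q * Q + (withoutDigit (g / Q) (g % Q / S) * S + g % Q % S) ∧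
        E.table 2 g < Q + g := by
    intro g hg
    obtain ⟨h1, h2, h3, h4⟩ := decode g hg
    have h5 := block_lt (withoutDigit_lt h2 h1) h3
    have h6 : E.table 2 g =
      g / Q * Q + (withoutDigit (g / Q) (g % Q / S) * S + g % Q % S) := by
      rw [hentry]
      exact hmod _ (hsmall _ (by simp only [tableEntry, ← hQdef]; omega))
    exact ⟨h6, by omega⟩
  have t4 : ∀ g < m * Q, E.table 4 g =
      g / Q * Q + (withDigit (g / Q) (g % Q / S) * S + g % Q % S) ∧
        E.table 4 g < Q + g := by
    intro g hg
    obtain ⟨h1, h2, h3, h4⟩ := decode g hg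
    have h5 := block_lt (withDigit_lt h2 h1) h3
    have h6 : E.table 4 g =
      g / Q * Q + (withDigit (g / Q) (g % Q / S) * S + g % Q % S) := by
      rw [hentry]
      exact hmod _ (hsmall _ (by simp only [tableEntry, ← hQdef]; omega))
    exact ⟨h6, by omega⟩
  have hnode : ∀ x : ZMod (2 ^ M), T.code x % 2 ^ m < 2 ^ m := fun x =>
    Nat.mod_lt _ (by positivity)
  have t5 : ∀ x, E.table 5 x = T.code x % 2 ^ m := by
    intro x
    rw [hentry]
    exact hmod _ (hsmall' _ ((hnode x).le.trans hmN))
  have t6 : ∀ x, E.table 6 x = m * Q + T.code x % 2 ^ m * S := by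
    intro x
    rw [hentry]
    refine hmod _ (hsmall _ ?_)
    have := block_lt (hnode x) hS
    simp only [tableEntry, ← hQdef]
    omega
  -- the nodes have at most `S` listed indices
  set F : ℕ → Finset ℕ := fun b => (Finset.range n).filter fun i' => E.table 5 (E.index i') = b
    with hF
  have hFcard : ∀ b < 2 ^ m, (F b).card ≤ S := by
    intro b hb
    refine le_trans ?_ (hload b hb)
    rw [← Set.ncard_coe_finset]
    refine Set.ncard_le_ncard_of_injOn (fun i => (E.index i : ZMod (2 ^ M))) ?_ ?_ (Set.toFinite _)
    · intro i hi
      obtain ⟨hi, hib⟩ := Finset.mem_filter.1 (Finset.mem_coe.1 hi)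
      have hi := Finset.mem_range.1 hi
      rw [t5] at hib
      exact ⟨hmemJ i hi, Finset.mem_coe.2 (Finset.mem_filter.2 ⟨hJ (hmemJ i hi), hib⟩)⟩
    · intro i hi i' hi' h
      have hi := Finset.mem_range.1 (Finset.mem_filter.1 (Finset.mem_coe.1 hi)).1
      have hi' := Finset.mem_range.1 (Finset.mem_filter.1 (Finset.mem_coe.1 hi')).1
      refine hinj i hi i' hi' ?_
      simpa [ZMod.natCast_eq_natCast_iff, Nat.ModEq, Nat.mod_eq_of_lt (hindex_lt _)] using h
  -- The load bound also controls the number of listed indices, and with it the cost of the phases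
  -- that loop over them.
  have hnQ : n ≤ Q := by
    have := Finset.card_le_mul_card_image_of_maps_to (s := Finset.range n)
      (t := Finset.range (2 ^ m)) (f := fun i => E.table 5 (E.index i))
      (fun i _ => Finset.mem_range.2 (by rw [t5]; exact hnode _)) S
      fun b hb => hFcard b (Finset.mem_range.1 hb)
    rw [Finset.card_range, Finset.card_range] at this
    linarith [mul_comm S (2 ^ m)]
  -- the Vandermonde systems
  set a := fourierCoefficient f with ha
  have hvander : ∀ i < n, _ := fun i (hi : i < n) => vandermonde_solution (F := F (E.table 5 (E.index i)))
    (z := fun i' => unityRoot M (E.index i')) (c := fun i' => 2 ^ m * a (E.index i'))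
    (y := fun t => T.listedValue a m S (E.table 6 (E.index i) + t)) (n := S) (i₀ := i)
    (fun i' _ => unityRoot_ne_zero _)
    (fun i' hi' i'' hi'' h => hinj i' (Finset.mem_range.1 (Finset.mem_filter.1
        (Finset.mem_coe.1 hi')).1) i'' (Finset.mem_range.1 (Finset.mem_filter.1
        (Finset.mem_coe.1 hi'')).1) (unityRoot_injOn (hindex_lt _) (hindex_lt _) h))
    (hFcard _ (by rw [t5]; exact hnode _))
    (fun t ht => by
      rw [t6, add_assoc, T.listedValue_block a m (hnode _) ht, T.stageValue_last,
        Nat.mod_mod]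
      symm
      refine Finset.sum_of_injOn (fun i' => (E.index i' : ZMod (2 ^ M))) ?_ ?_ ?_ ?_
      · intro i' hi' i'' hi'' h
        have hi' := Finset.mem_range.1 (Finset.mem_filter.1 (Finset.mem_coe.1 hi')).1
        have hi'' := Finset.mem_range.1 (Finset.mem_filter.1 (Finset.mem_coe.1 hi'')).1
        refine hinj i' hi' i'' hi'' ?_
        simpa [ZMod.natCast_eq_natCast_iff, Nat.ModEq, Nat.mod_eq_of_lt (hindex_lt _)] using h
      · intro i' hi'
        obtain ⟨hi', hib⟩ := Finset.mem_filter.1 (Finset.mem_coe.1 hi')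
        rw [t5, t5] at hib
        exact Finset.mem_coe.2 (Finset.mem_filter.2 ⟨hJ (hmemJ i' (Finset.mem_range.1 hi')), hib⟩)
      · intro j hj hj'
        -- The node sum runs over all of `K`; frequencies that are not listed lie outside `J`, where
        -- the coefficients vanish.
        have : j ∉ J := by
          intro hjJ
          obtain ⟨i', hi'⟩ := e.surjective ⟨j, hjJ⟩
          have hj'' : (E.index i' : ZMod (2 ^ M)) = j := by rw [hcast i' i'.2, hi']
          refine hj' ⟨i', Finset.mem_coe.2 (Finset.mem_filter.2 ⟨Finset.mem_range.2 i'.2, ?_⟩), hj''⟩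
          rw [t5, t5, hj'']
          exact (Finset.mem_filter.1 hj).2
        rw [ha, fourierCoefficient, hf j this]
        simp
      · intro i' _
        rw [unityRoot_eq])
    (Finset.mem_filter.2 ⟨Finset.mem_range.2 hi, rfl⟩)
  have hfits : E.Fits := by
    refine ⟨?_, fun x y => ?_, fun i => ?_, ?_⟩
    · nlinarith
    · rw [hentry]
      exact Nat.mod_lt _ (by positivity)
    · have := hsmall' _ (hindex_lt i).le
      omega
    · have := hsmall n (by omega)
      rw [hsize]
      omega
  obtain ⟨t, s, hexec, ht, hs⟩ := halts_dftProgram hfits (V := T.listedValue a m S)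
    (by rw [t01]; exact hsmall' _ hmN)
    (by rw [t00, t02]; have := hsmall _ le_rfl; omega)
    (by rw [t03]; have := hsmall S (by omega); omega)
    (fun q hq => by
      rw [t00] at hq
      have h1 : q / S < 2 ^ m := Nat.div_lt_of_lt_mul (by rwa [mul_comm])
      have h2 := T.listedValue_block a 0 h1 (Nat.mod_lt q hS)
      rw [zero_mul, zero_add, Nat.div_add_mod'] at h2
      rw [h2, stageValue, T.nodeSum_zero hJ hf, t1, ZMod.natCast_zmod_val, pow_zero, one_mul]
      rfl)
    (fun g hg => by rw [t02] at hg; rw [t00]; exact (t2 g hg).2)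
    (fun g hg => by rw [t02] at hg; rw [t00]; exact (t4 g hg).2)
    (fun g hg => by
      rw [t02] at hg
      obtain ⟨h1, h2, h3, h4⟩ := decode g hg
      have e1 := T.listedValue_block a (g / Q + 1) h2 h3
      rw [show (g / Q + 1) * (2 ^ m * S) + (g % Q / S * S + g % Q % S) = Q + g by
        rw [Nat.div_add_mod', ← hQdef]
        linarith [Nat.div_add_mod' g Q]] at e1
      rw [t00, (t2 g hg).1, (t4 g hg).1, t3, e1, T.stageValue_succ a hm h1 h2, hQdef,
        T.listedValue_block a _ (withoutDigit_lt h2 h1) h3,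
        T.listedValue_block a _ (withDigit_lt h2 h1) h3])
    (fun i hi => by rw [t01, t5]; exact hnode _)
    (fun i hi => by
      rw [t00, t02, t03, t6]
      have := block_lt (hnode (E.index i)) (show S - 1 < S by omega)
      omega)
    (fun i hi => by rw [t03]; exact (hvander i hi).1)
  refine ⟨t, s, hprogram ▸ hexec, ?_, fun i => ?_⟩
  · rw [t00, t01, t02, t03, hsize] at ht
    refine Nat.cast_le.2 (ht.trans ?_)
    have := Nat.mul_le_mul_right (170 * S + 110) hnQ
    omega
  · rw [hs i i.2, t03, t04]
    have h := (hvander i i.2).2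
    refine (congrArg (· * ((2 ^ (M - m) : ℕ) : ℂ)) h).trans ?_
    rw [hcast i i.2, ha, fourierCoefficient]
    -- The solved unknown is `2 ^ m * 𝓕 f j / 2 ^ M`; the table entry `2 ^ (M - m)` removes the
    -- remaining factor.
    have : (2 : ℂ) ^ M = 2 ^ m * 2 ^ (M - m) := by rw [← pow_add, Nat.add_sub_cancel' hmM]
    rw [this]
    push_cast
    field_simp

end Correctness

/-! ## Random subsets -/

section RandomSubset

variable {α : Type*} [Fintype α] {K : Finset α} {k : ℕ}

instance (hk : k ≤ K.card) : IsProbabilityMeasure (randomSubset K k hk) := by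
  unfold randomSubset
  infer_instance

lemma randomSubset_not_subset (hk : k ≤ K.card) :
    (randomSubset K k hk).real {J | ¬ J ⊆ K} = 0 := by
  rw [measureReal_def]
  have : ∀ᵐ J ∂(randomSubset K k hk), J ⊆ (K : Set α) := setBernoulli_ae_subset
  rw [ae_iff.1 this, ENNReal.toReal_zero]

/-- The probability generating function of the number of elements in a given set. -/
lemma integral_randomSubset (hk : k ≤ K.card) {A : Finset α} (hA : A ⊆ K) (c : ℝ) :
    ∫ J, c ^ (J ∩ A).ncard ∂(randomSubset K k hk) =
      (1 + (k / K.card : ℝ) * (c - 1)) ^ A.card := by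
  classical
  set p : ℝ := k / K.card with hp
  -- With these weights `∏ i ∈ t, w i = c ^ |t ∩ A|`, and expanding `∏ i ∈ K, (p * w i + (1 - p))`
  -- gives the expectation as a sum over the subsets of `K`.
  set w : α → ℝ := fun i => if i ∈ A then c else 1 with hw
  have hterm : ∀ t ∈ K.powerset, (∏ i ∈ t, p * w i) * ∏ i ∈ K \ t, (1 - p) =
      (randomSubset K k hk).real {(t : Set α)} • c ^ ((t : Set α) ∩ A).ncard := by
    intro t ht
    have ht := Finset.mem_powerset.1 ht
    rw [randomSubset, setBernoulli_real_singleton _ (Finset.coe_subset.2 ht) (Finset.finite_toSet K),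
      Finset.prod_mul_distrib, Finset.prod_const, Finset.prod_const, ← Finset.coe_sdiff,
      ← Finset.coe_inter, Set.ncard_coe_finset, Set.ncard_coe_finset, Set.ncard_coe_finset, hw,
      ← Finset.prod_filter, Finset.prod_const, Finset.filter_mem_eq_inter, smul_eq_mul]
    ring
  rw [integral_fintype Integrable.of_finite]
  calc _ = ∑ t ∈ K.powerset, (∏ i ∈ t, p * w i) * ∏ i ∈ K \ t, (1 - p) := by
        symm
        refine Finset.sum_of_injOn (fun t : Finset α => (t : Set α))
          (fun _ _ _ _ h => Finset.coe_injective h) (fun _ _ => Finset.mem_coe.2 (Finset.mem_univ _))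
          (fun J _ hJ => ?_) hterm
        have : ¬ J ⊆ K := fun h => hJ ⟨J.toFinset,
          Finset.mem_coe.2 (Finset.mem_powerset.2 (by simpa [← Finset.coe_subset] using h)),
          by simp⟩
        have h0 : (randomSubset K k hk).real {J} ≤ (randomSubset K k hk).real {J | ¬ J ⊆ K} :=
          measureReal_mono (Set.singleton_subset_iff.2 this)
        rw [randomSubset_not_subset] at h0
        rw [le_antisymm h0 measureReal_nonneg, zero_smul]
    _ = ∏ i ∈ K, (p * w i + (1 - p)) := (Finset.prod_add _ _ _).symm
    _ = ∏ i ∈ A, (p * w i + (1 - p)) := by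
        refine (Finset.prod_subset hA fun i _ hi => ?_).symm
        simp [hw, hi]
    _ = _ := by
        rw [Finset.prod_congr rfl fun i hi => show p * w i + (1 - p) = 1 + p * (c - 1) by
          simp only [hw, if_pos hi]; ring, Finset.prod_const]

/-- Markov's inequality for `c ^ |J ∩ A|`, combined with `1 + u ≤ exp u`. Taking `c > 1` gives upper
tails and `c < 1` lower tails. -/
lemma randomSubset_markov (hk : k ≤ K.card) {A : Finset α} (hA : A ⊆ K) {c : ℝ} (hc : 0 < c)
    {x : ℝ} (hx : 0 < x) {G : Set (Set α)} (hG : ∀ J ∈ G, x ≤ c ^ (J ∩ A).ncard) :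
    (randomSubset K k hk).real G ≤
      x⁻¹ * Real.exp ((k / K.card : ℝ) * (c - 1) * A.card) := by
  have h := mul_meas_ge_le_integral_of_nonneg (μ := randomSubset K k hk)
    (f := fun J => c ^ (J ∩ A).ncard) (ae_of_all _ fun J => by positivity)
    Integrable.of_finite x
  rw [integral_randomSubset hk hA] at h
  have hp0 : (0 : ℝ) ≤ k / K.card := by positivity
  have hp1 : (k / K.card : ℝ) ≤ 1 := div_le_one_of_le₀ (by exact_mod_cast hk) (by positivity)
  have h1 : (1 + (k / K.card : ℝ) * (c - 1)) ^ A.card ≤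
      Real.exp ((k / K.card : ℝ) * (c - 1) * A.card) := by
    rw [mul_comm _ (A.card : ℝ), Real.exp_nat_mul]
    refine pow_le_pow_left₀ (by nlinarith) ?_ _
    rw [add_comm]
    exact Real.add_one_le_exp _
  rw [inv_mul_eq_div, le_div_iff₀' hx]
  refine le_trans ?_ (h.trans h1)
  exact mul_le_mul_of_nonneg_left (measureReal_mono fun J hJ => hG J hJ) hx.le

lemma randomSubset_upper_tail (hk : k ≤ K.card) {A : Finset α} (hA : A ⊆ K) (x : ℕ) :
    (randomSubset K k hk).real {J | x ≤ (J ∩ A).ncard} ≤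
      (2 ^ x)⁻¹ * Real.exp ((k / K.card : ℝ) * A.card) := by
  have := randomSubset_markov hk hA (c := 2) (by norm_num) (x := 2 ^ x) (by positivity)
    (G := {J | x ≤ (J ∩ A).ncard}) fun J hJ => pow_le_pow_right₀ (by norm_num) hJ
  refine this.trans_eq ?_
  norm_num

lemma randomSubset_lower_tail (hk : k ≤ K.card) {A : Finset α} (hA : A ⊆ K) (x : ℕ) :
    (randomSubset K k hk).real {J | (J ∩ A).ncard ≤ x} ≤
      2 ^ x * Real.exp (-((k / K.card : ℝ) * A.card / 2)) := by
  have := randomSubset_markov hk hA (c := 1 / 2) (by norm_num) (x := (1 / 2) ^ x) (by positivity)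
    (G := {J | (J ∩ A).ncard ≤ x}) fun J hJ =>
      pow_le_pow_of_le_one (by norm_num) (by norm_num) hJ
  refine this.trans_eq ?_
  rw [one_div, inv_pow, inv_inv]
  congr 2
  ring

end RandomSubset

/-! ### Concentration of the size of the random set. -/

lemma tendsto_measure_one {Ω : ℕ → Type*} [∀ M, MeasurableSpace (Ω M)]
    [∀ M, DiscreteMeasurableSpace (Ω M)] {μ : ∀ M, Measure (Ω M)}
    [∀ M, IsProbabilityMeasure (μ M)] {G : ∀ M, Set (Ω M)} {ε : ℕ → ℝ}
    (h : ∀ᶠ M in atTop, (μ M).real (G M)ᶜ ≤ ε M) (hε : Tendsto ε atTop (𝓝 0)) :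
    Tendsto (fun M => μ M (G M)) atTop (𝓝 1) := by
  have h1 : Tendsto (fun M => (μ M).real (G M)) atTop (𝓝 1) := by
    refine tendsto_of_tendsto_of_tendsto_of_le_of_le' (g := fun M => 1 - ε M) (h := fun _ => 1)
      (by simpa using hε.const_sub 1) tendsto_const_nhds ?_ (Eventually.of_forall fun M =>
        measureReal_le_one)
    filter_upwards [h] with M hM
    rw [probReal_compl_eq_one_sub (.of_discrete)] at hM
    linarith
  have h2 := ENNReal.tendsto_ofReal h1
  simpa using h2

lemma pow_two_le_exp (x : ℕ) : (2 : ℝ) ^ x ≤ Real.exp x := by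
  have := pow_le_pow_left₀ (by norm_num) (show (2 : ℝ) ≤ Real.exp 1 by
    linarith [Real.add_one_le_exp (1 : ℝ)]) x
  rwa [← Real.exp_nat_mul, mul_one] at this

lemma exp_le_four_pow (x : ℕ) : Real.exp x ≤ (4 : ℝ) ^ x := by
  have := pow_le_pow_left₀ (Real.exp_pos 1).le (show Real.exp 1 ≤ 4 by
    linarith [Real.exp_one_lt_d9]) x
  rwa [← Real.exp_nat_mul, mul_one] at this

theorem isStochasticFamily_randomSubset (K : (M : ℕ) → Finset (ZMod (2 ^ M)))
    (hK : ∀ M, (K M).Nonempty) (k : ℕ → ℕ) (hk : ∀ M, k M ≤ (K M).card)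
    (hk_top : Tendsto k atTop atTop) :
    IsStochasticFamily (fun M => randomSubset (K M) (k M) (hk M)) k := by
  -- The expected size is `k`. The lower tail is at most `2 ^ (k / 4) * exp (-k / 2) ≤ exp (-k /
  -- 4)`, the upper tail at most `2 ^ (-4 k) * exp k ≤ 4 ^ (-k)`.
  refine ⟨fun M => inferInstance, hk_top, 1 / 4, 4, by norm_num, by norm_num, ?_⟩
  have hkr : Tendsto (fun M => (k M : ℝ)) atTop atTop :=
    tendsto_natCast_atTop_atTop.comp hk_top
  refine tendsto_measure_one (ε := fun M => Real.exp (-(k M / 4 : ℝ)) + (1 / 4) ^ k M)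
    (Eventually.of_forall fun M => ?_) ?_
  · set μ := randomSubset (K M) (k M) (hk M) with hμ
    have hcard : ((k M : ℝ) / (K M).card) * (K M).card = k M :=
      div_mul_cancel₀ _ (by exact_mod_cast (Finset.card_pos.2 (hK M)).ne')
    have hsub : {J : Set (ZMod (2 ^ M)) | 1 / 4 * (k M : ℝ) ≤ (J.ncard : ℝ) ∧
        (J.ncard : ℝ) ≤ 4 * k M}ᶜ ⊆ {J | ¬ J ⊆ K M} ∪ ({J | (J ∩ K M).ncard ≤ k M / 4} ∪
          {J | 4 * k M ≤ (J ∩ K M).ncard}) := by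
      intro J hJ
      by_cases hJK : J ⊆ K M
      · right
        simp only [Set.mem_union, Set.mem_ofPred_eq, Set.inter_eq_left.2 hJK]
        by_contra! hcon
        refine hJ ⟨?_, ?_⟩
        · have h := hcon.1
          have : k M ≤ 4 * J.ncard := by omega
          have : (k M : ℝ) ≤ 4 * J.ncard := by exact_mod_cast this
          linarith
        · exact_mod_cast hcon.2.le
      · exact Or.inl hJK
    refine (measureReal_mono hsub).trans ((measureReal_union_le _ _).trans ?_)
    rw [randomSubset_not_subset, zero_add]
    refine (measureReal_union_le _ _).trans (add_le_add ?_ ?_)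
    · refine (randomSubset_lower_tail (hk M) subset_rfl _).trans ?_
      rw [hcard]
      refine (mul_le_mul_of_nonneg_right (pow_two_le_exp _) (Real.exp_pos _).le).trans ?_
      rw [← Real.exp_add]
      refine Real.exp_le_exp.2 ?_
      have : ((k M / 4 : ℕ) : ℝ) ≤ (k M : ℝ) / 4 := Nat.cast_div_le
      linarith
    · refine (randomSubset_upper_tail (hk M) subset_rfl _).trans ?_
      rw [hcard]
      refine (mul_le_mul_of_nonneg_left (exp_le_four_pow _) (by positivity)).trans_eq ?_
      rw [pow_mul, ← inv_pow, ← mul_pow]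
      norm_num
  · have h1 : Tendsto (fun M => Real.exp (-(k M / 4 : ℝ))) atTop (𝓝 0) :=
      Real.tendsto_exp_neg_atTop_nhds_zero.comp (hkr.atTop_div_const (by norm_num))
    have h2 : Tendsto (fun M => (1 / 4 : ℝ) ^ k M) atTop (𝓝 0) :=
      (tendsto_pow_atTop_nhds_zero_of_lt_one (by norm_num) (by norm_num)).comp hk_top
    simpa using h1.add h2

/-! ## Fourier computability -/

section Computability

variable {M : ℕ} {K : Finset (ZMod (2 ^ M))} {P : ℕ}

lemma StructuredDFT.ComputesWithin.mono {A : StructuredDFT} {J : Set (ZMod (2 ^ M))} {T T' : ℝ}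
    (h : A.ComputesWithin J T) (hT : T ≤ T') : A.ComputesWithin J T' := fun n e f hf => by
  obtain ⟨t, s, hexec, ht, hs⟩ := h n e f hf
  exact ⟨t, s, hexec, ht.trans hT, hs⟩

/-- In a node the code is fixed modulo `2 ^ m`, so its quotient by `2 ^ m` identifies the element.
-/
lemma TreeEnumeration.card_node_le (T : TreeEnumeration K P) {m : ℕ} (hm : m ≤ P) (b : ℕ) :
    (T.node m b).card ≤ 2 ^ (P - m) := by
  rw [← Finset.card_range (2 ^ (P - m))]
  refine Finset.card_le_card_of_injOn (fun j => T.code j / 2 ^ m) (fun j hj => ?_) ?_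
  · have := T.code_lt j (Finset.mem_filter.1 hj).1
    refine Finset.mem_coe.2 (Finset.mem_range.2 (Nat.div_lt_of_lt_mul ?_))
    rwa [← pow_add, Nat.add_sub_cancel' hm]
  · intro j hj j' hj' h
    obtain ⟨hjK, hjb⟩ := Finset.mem_filter.1 (Finset.mem_coe.1 hj)
    obtain ⟨hjK', hjb'⟩ := Finset.mem_filter.1 (Finset.mem_coe.1 hj')
    have : T.code j = T.code j' := by
      rw [← Nat.div_add_mod (T.code j) (2 ^ m), ← Nat.div_add_mod (T.code j') (2 ^ m), hjb, hjb']
      dsimp only at h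
      rw [h]
    rw [← T.elem_code j hjK, this, T.elem_code j' hjK']

/-- The number of levels treated by butterflies when about `k` frequencies are expected. -/
def splitLevel (k : ℕ) : ℕ := Nat.log 2 (k / Nat.log 2 k)

/-- The number of samples taken for each node when about `k` frequencies are expected. -/
def nodeCapacity (k : ℕ) : ℕ := 5 * Nat.log 2 k

lemma log_pos_of_two_le {k : ℕ} (hk : 2 ≤ k) : 0 < Nat.log 2 k := Nat.log_pos (by norm_num) hk

lemma two_pow_splitLevel_le {k : ℕ} (hk : 2 ≤ k) : 2 ^ splitLevel k ≤ k / Nat.log 2 k :=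
  Nat.pow_log_le_self 2 (Nat.div_pos (Nat.log_le_self 2 k) (log_pos_of_two_le hk)).ne'

lemma two_pow_splitLevel_mul_le {k : ℕ} (hk : 2 ≤ k) :
    2 ^ splitLevel k * nodeCapacity k ≤ 5 * k :=
  calc 2 ^ splitLevel k * nodeCapacity k = 5 * (2 ^ splitLevel k * Nat.log 2 k) := by
        rw [nodeCapacity]; ring
    _ ≤ 5 * k := Nat.mul_le_mul_left 5 ((Nat.mul_le_mul_right _ (two_pow_splitLevel_le hk)).trans
        (Nat.div_mul_le_self _ _))

/-- Rounding `k / log k` down to a power of two loses at most a factor of two; hence the expected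
load of a node is at most `2 log k`. -/
lemma lt_two_pow_splitLevel_mul {k : ℕ} (hk : 2 ≤ k) :
    k < 2 ^ splitLevel k * (2 * Nat.log 2 k) := by
  have := (Nat.div_lt_iff_lt_mul (log_pos_of_two_le hk)).1
    (Nat.lt_pow_succ_log_self (b := 2) (by norm_num) (k / Nat.log 2 k))
  rw [Nat.succ_eq_add_one, pow_succ] at this
  rw [splitLevel, ← mul_assoc]
  exact this

lemma splitLevel_le_log (k : ℕ) : splitLevel k ≤ Nat.log 2 k :=
  Nat.log_mono_right (Nat.div_le_self _ _)

/-- Every summand is at most a constant times `k log k`; the constants are `150 + 250 + 30 + 4800 +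
60`. -/
lemma operations_le {k : ℕ} (hk : 2 ≤ k) :
    30 * (2 ^ splitLevel k * nodeCapacity k) +
      50 * (splitLevel k * (2 ^ splitLevel k * nodeCapacity k)) + 30 * 2 ^ splitLevel k +
      2 ^ splitLevel k * nodeCapacity k * (170 * nodeCapacity k + 110) + 60 ≤
    5290 * (k * Nat.log 2 k) := by
  have hL := log_pos_of_two_le hk
  have h1 := two_pow_splitLevel_mul_le hk
  have h2 := (two_pow_splitLevel_le hk).trans (Nat.div_le_self _ _)
  have h3 := Nat.mul_le_mul (splitLevel_le_log k) h1
  have h4 : 170 * nodeCapacity k + 110 ≤ 960 * Nat.log 2 k := by rw [nodeCapacity]; omega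
  have h5 := Nat.mul_le_mul h1 h4
  have h6 : k ≤ k * Nat.log 2 k := Nat.le_mul_of_pos_right _ hL
  nlinarith

/-- All nodes have at most `nodeCapacity k` elements, except with probability `2 / 2 ^ log₂ k`. -/
lemma randomSubset_overfull (hP : K.card = 2 ^ P) (T : TreeEnumeration K P) {k : ℕ} (hk2 : 2 ≤ k)
    (hk : k ≤ K.card) (hm : splitLevel k ≤ P) :
    (randomSubset K k hk).real {J | ¬ (J ⊆ K ∧ ∀ b < 2 ^ splitLevel k,
      (J ∩ T.node (splitLevel k) b).ncard ≤ nodeCapacity k)} ≤ 2 * (1 / 2) ^ Nat.log 2 k := by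
  set μ := randomSubset K k hk with hμ
  set L := Nat.log 2 k with hL
  set m := splitLevel k with hmdef
  have hsub : {J : Set (ZMod (2 ^ M)) | ¬ (J ⊆ K ∧ ∀ b < 2 ^ m, (J ∩ T.node m b).ncard ≤ nodeCapacity k)} ⊆
      {J | ¬ J ⊆ K} ∪ ⋃ b ∈ Finset.range (2 ^ m),
        {J : Set (ZMod (2 ^ M)) | nodeCapacity k ≤ (J ∩ T.node m b).ncard} := by
    intro J hJ
    by_cases hJK : J ⊆ K
    · right
      simp only [Set.mem_ofPred_eq, hJK, true_and, not_forall, not_le] at hJ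
      obtain ⟨b, hb, h⟩ := hJ
      exact Set.mem_biUnion (Finset.mem_coe.2 (Finset.mem_range.2 hb)) h.le
    · exact Or.inl hJK
  refine (measureReal_mono hsub).trans ((measureReal_union_le _ _).trans ?_)
  rw [randomSubset_not_subset, zero_add]
  refine (measureReal_biUnion_finset_le _ _).trans ?_
  have hone : ∀ b ∈ Finset.range (2 ^ m),
      μ.real {J | nodeCapacity k ≤ (J ∩ T.node m b).ncard} ≤ (1 / 4) ^ L := by
    intro b _
    refine (randomSubset_upper_tail hk (Finset.filter_subset _ _) _).trans ?_
    -- A node has at most `2 ^ (P - m)` of the `2 ^ P` elements, so its expected load is at most `k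
    -- / 2 ^ m`.
    have hmean : (k / K.card : ℝ) * (T.node m b).card ≤ 2 * L := by
      have h1 : ((T.node m b).card : ℝ) ≤ 2 ^ (P - m) := by exact_mod_cast T.card_node_le hm b
      have h2 : (k : ℝ) ≤ 2 ^ m * (2 * L) := by
        exact_mod_cast (lt_two_pow_splitLevel_mul hk2).le
      have h3 : (2 : ℝ) ^ P = 2 ^ m * 2 ^ (P - m) := by rw [← pow_add, Nat.add_sub_cancel' hm]
      rw [hP, div_mul_eq_mul_div, div_le_iff₀ (by positivity)]
      push_cast
      calc (k : ℝ) * (T.node m b).card ≤ (2 ^ m * (2 * L)) * 2 ^ (P - m) := by gcongr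
        _ = 2 * L * 2 ^ P := by rw [h3]; ring
    -- This explains the capacity `5 L`: the tail `2 ^ (-5 L) * 8 ^ L = 4 ^ (-L)` still beats the
    -- number of nodes, which is at most `2 * 2 ^ L`.
    have hexp : Real.exp (2 * L) ≤ 8 ^ L := by
      have h1 : Real.exp 2 ≤ 8 := by
        have := Real.exp_one_lt_d9
        have h2 : Real.exp 2 = Real.exp 1 * Real.exp 1 := by rw [← Real.exp_add]; norm_num
        rw [h2]
        nlinarith [Real.exp_pos 1]
      rw [mul_comm, Real.exp_nat_mul]
      exact pow_le_pow_left₀ (Real.exp_pos _).le h1 _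
    calc ((2 : ℝ) ^ nodeCapacity k)⁻¹ * Real.exp ((k / K.card : ℝ) * (T.node m b).card)
        ≤ (2 ^ nodeCapacity k)⁻¹ * 8 ^ L := by
          gcongr
          exact (Real.exp_le_exp.2 hmean).trans hexp
      _ = (1 / 4) ^ L := by
          rw [nodeCapacity, pow_mul, ← inv_pow, ← hL, ← mul_pow]
          norm_num
  refine (Finset.sum_le_sum hone).trans ?_
  rw [Finset.sum_const, Finset.card_range, nsmul_eq_mul]
  have h1 : 2 ^ m ≤ 2 ^ (L + 1) := ((two_pow_splitLevel_le hk2).trans (Nat.div_le_self _ _)).trans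
    (Nat.lt_pow_succ_log_self (by norm_num) k).le
  have h2 : ((2 ^ m : ℕ) : ℝ) ≤ 2 * 2 ^ L := by
    rw [pow_succ, mul_comm] at h1
    exact_mod_cast h1
  calc ((2 ^ m : ℕ) : ℝ) * (1 / 4) ^ L ≤ 2 * 2 ^ L * (1 / 4) ^ L := by gcongr
    _ = 2 * (1 / 2) ^ L := by rw [mul_assoc, ← mul_pow]; norm_num

end Computability

/-- The DFT algorithm for random subsets of homogeneous sets. -/
noncomputable def homogeneousDFT (K : (M : ℕ) → Finset (ZMod (2 ^ M)))
    (hK : ∀ M, IsHomogeneous (K M)) (k : ℕ → ℕ) : StructuredDFT where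
  program := dftProgram
  table M a b := (exists_treeEnumeration (hK M)).some.tableEntry (splitLevel (k M))
    (nodeCapacity (k M)) a b % 2 ^ (5 * (M + 1))
  wordFactor := 5

theorem fourierComputable_randomSubset (K : (M : ℕ) → Finset (ZMod (2 ^ M)))
    (hK : ∀ M, IsHomogeneous (K M)) (k : ℕ → ℕ) (hk : ∀ M, k M ≤ (K M).card)
    (hk_top : Tendsto k atTop atTop) :
    FourierComputable (fun M => randomSubset (K M) (k M) (hk M)) k := by
  refine ⟨homogeneousDFT K hK k, 5290, by norm_num, ?_⟩
  refine tendsto_measure_one (ε := fun M => 2 * (1 / 2) ^ Nat.log 2 (k M)) ?_ ?_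
  -- For `k < 2` the integer logarithm, and with it the node capacity, would be zero.
  · filter_upwards [hk_top.eventually_ge_atTop 2] with M hkM
    let T := (exists_treeEnumeration (hK M)).some
    have hPcard : (K M).card = 2 ^ (pivots (K M)).card := hK M
    have hmk := (two_pow_splitLevel_le hkM).trans (Nat.div_le_self _ _)
    have hKN : (K M).card ≤ 2 ^ M := by
      simpa [ZMod.card] using Finset.card_le_univ (K M)
    have hm : splitLevel (k M) ≤ (pivots (K M)).card := by
      rw [← Nat.pow_le_pow_iff_right (a := 2) (by norm_num), ← hPcard]
      exact hmk.trans (hk M)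
    have hPM : (pivots (K M)).card ≤ M := by
      rw [← Nat.pow_le_pow_iff_right (a := 2) (by norm_num), ← hPcard]
      exact hKN
    refine le_trans (measureReal_mono ?_) (randomSubset_overfull hPcard T hkM (hk M) hm)
    refine fun J hJ hJ' => hJ ?_
    refine (T.computesWithin (A := homogeneousDFT K hK k) rfl rfl rfl hm hPM
      ((two_pow_splitLevel_mul_le hkM).trans (Nat.mul_le_mul_left 5 ((hk M).trans hKN)))
      (Nat.mul_pos (by norm_num) (log_pos_of_two_le hkM)) hJ'.1 hJ'.2).mono ?_
    have hlog : (Nat.log 2 (k M) : ℝ) ≤ Real.logb 2 (k M) := by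
      have := Real.natLog_le_logb (k M) 2
      exact_mod_cast this
    calc _ ≤ ((5290 * (k M * Nat.log 2 (k M)) : ℕ) : ℝ) := Nat.cast_le.2 (operations_le hkM)
      _ = 5290 * (k M * (Nat.log 2 (k M) : ℝ)) := by push_cast; ring
      _ ≤ 5290 * (k M * Real.logb 2 (k M)) := by gcongr
  · have h1 : Tendsto (fun M => Nat.log 2 (k M)) atTop atTop :=
      tendsto_atTop.2 fun b => (hk_top.eventually_ge_atTop (2 ^ b)).mono fun M hM =>
        Nat.le_log_of_pow_le (by norm_num) hM
    have h2 := (tendsto_pow_atTop_nhds_zero_of_lt_one (r := (1 / 2 : ℝ)) (by norm_num)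
      (by norm_num)).comp h1
    simpa using h2.const_mul 2

theorem mainTheorem5 (K : (M : ℕ) → Finset (ZMod (2 ^ M))) (hK : ∀ M, IsHomogeneous (K M))
    (k : ℕ → ℕ) (hk : ∀ M, k M ≤ (K M).card) (hk_top : Tendsto k atTop atTop) :
    IsStochasticFamily (fun M => randomSubset (K M) (k M) (hk M)) k ∧
      FourierComputable (fun M => randomSubset (K M) (k M) (hk M)) k :=
  ⟨isStochasticFamily_randomSubset K (fun M => Finset.card_pos.1 (by rw [hK M]; positivity)) k hk
    hk_top, fourierComputable_randomSubset K hK k hk hk_top⟩
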